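/- Let $(\Omega,\mathcal F,\mathbb P)$ be a nonatomic probability space, and let $\mathcal X=L^\infty(\Omega,\mathcal F,\mathbb P)$. Let $u_1,u_2:\mathbb R\to\mathbb R$ be twice differentiable, strictly concave and increasing. Let $T:[0,1]\to[0,1]$ be continuous and strictly increasing, with $T(0)=0$ and $T(1)=1$, and twice differentiable on $(0,1)$. Let $\mathtt w\in\mathbb R$, let $f:[0,\mathtt w]\to[0,1]$ be strictly increasing and concave with $f(0)=0$, and let $\lambda_2>0$. For $M\in[0,\mathtt w]$ put $T_M(p)=(1-f(M))\,T(p)+f(M)\,p$, and consider the problem $$(\ast)_M\qquad \sup\Big\{\int u_1(X_1)\,d(T_M\circ\mathbb P)+\lambda_2\int u_2(X_2)\,d\mathbb P\ :\ X_1,X_2\in\mathcal X,\ X_1+X_2=\mathtt w-M \text{ a.s.}\Big\},$$ where the first integral is a Choquet integral. Let $\delta$ be the convex envelope on $[0,1]$ of $t\mapsto 1-T(1-t)$, and let $$m_{\lambda_2}(x)=m_{\lambda_2}(x;M)=\lambda_2\,\frac{u_2'(\mathtt w-M-x)}{u_1'(x)},\qquad \phi_M(p)=\delta'(p)-f(M)\,(\delta'(p)-1).$$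 Then $\delta$ is differentiable on $(0,1)$ and, for every $M\in[0,\mathtt w]$, $m_{\lambda_2}$ is strictly increasing in $x$. Write $m_{\lambda_2}^{-1}$ for its inverse, defined on its range, and $x_M(p)=m_{\lambda_2}^{-1}(\phi_M(p))$ whenever $\phi_M(p)$ lies in that range. 1. For every $M\in[0,\mathtt w]$ and all $X_1,X_2\in\mathcal X$, the pair $(X_1,X_2)$ solves $(\ast)_M$ if and only if there is a random variable $\mathtt U$ on $\Omega$, uniformly distributed on $(0,1)$, such that almost surely $x_M(\mathtt U)$ is defined and $$X_1=x_M(\mathtt U)=m_{\lambda_2}^{-1}\big(\delta'(\mathtt U)-f(M)(\delta'(\mathtt U)-1)\big),\qquad X_2=\mathtt w-M-x_M(\mathtt U).$$ 2. For every $M\in[0,\mathtt w]$ and every $y$ in the range of $m_{\lambda_2}$, $m_{\lambda_2}$ is differentiable in $x$ at $m_{\lambda_2}^{-1}(y)$, and $\Lambda(y):=\big(\tfrac{d}{dx}m_{\lambda_2}\big)\big(m_{\lambda_2}^{-1}(y)\big)$ equals $$\Lambda(y)=\frac{-\lambda_2}{u_1'(z)}\left[u_2''(\mathtt w-M-z)+u_2'(\mathtt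 w-M-z)\,\frac{u_1''(z)}{u_1'(z)}\right],\qquad z=m_{\lambda_2}^{-1}(y).$$ Let moreover $p\in(0,1)$ be such that $x_M(p)$ is defined and $\Lambda(\phi_M(p))\neq0$. If $f$ is differentiable at $M$, then $N\mapsto x_N(p)$ is differentiable at $N=M$, with $$\frac{\partial}{\partial M}x_M(p)=\frac{-f'(M)\,(\delta'(p)-1)+\lambda_2\,\dfrac{u_2''\big(\mathtt w-M-m_{\lambda_2}^{-1}(\phi_M(p))\big)}{u_1'\big(m_{\lambda_2}^{-1}(\phi_M(p))\big)}}{\Lambda(\phi_M(p))}.$$ If $1\le k\le\infty$, $u_1$ and $u_2$ are of class $C^{k+1}$, and $f$ is of class $C^k$ on $[0,\mathtt w]$, then $N\mapsto x_N(p)$ is of class $C^k$ at $N=M$. (Derivatives and regularity in $M$ are relative to $[0,\mathtt w]$, hence one-sided at the endpoints.) -/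

import Mathlib

open MeasureTheory Set

noncomputable section

namespace Nudging

/-- A measure is nonatomic if every measurable set of positive measure has a measurable subset
of strictly smaller, positive measure. -/
def IsNonatomic {Ω : Type*} [MeasurableSpace Ω] (P : Measure Ω) : Prop :=
  ∀ A, MeasurableSet A → 0 < P A → ∃ B, B ⊆ A ∧ MeasurableSet B ∧ 0 < P B ∧ P B < P A

/-- Utility functions of wealth: twice differentiable, strictly concave and increasing on `ℝ`. -/
structure IsUtility (u : ℝ → ℝ) : Prop where
  differentiable : Differentiable ℝ u
  differentiable_deriv : Differentiable ℝ (deriv u)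
  strictConcave : StrictConcaveOn ℝ univ u
  mono : Monotone u

/-- Probability weighting functions `T : [0,1] → [0,1]`; only the values on `[0,1]` matter.
Twice differentiability is required on the open interval, continuity on the closed one. -/
structure IsWeighting (T : ℝ → ℝ) : Prop where
  zero : T 0 = 0
  one : T 1 = 1
  strictMono : StrictMonoOn T (Icc 0 1)
  continuousOn : ContinuousOn T (Icc 0 1)
  differentiableOn : DifferentiableOn ℝ T (Ioo 0 1)
  differentiableOn_deriv : DifferentiableOn ℝ (deriv T) (Ioo 0 1)

/-- Nudging functions `f : [0,w] → [0,1]`: strictly increasing, concave, with `f 0 = 0`;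
only the values on `[0,w]` matter. -/
structure IsNudge (w : ℝ) (f : ℝ → ℝ) : Prop where
  mapsTo : MapsTo f (Icc 0 w) (Icc 0 1)
  strictMono : StrictMonoOn f (Icc 0 w)
  concave : ConcaveOn ℝ (Icc 0 w) f
  zero : f 0 = 0

/-- The Choquet integral of `Z` with respect to the set function `ν`. -/
def choquet {Ω : Type*} (ν : Set Ω → ℝ) (Z : Ω → ℝ) : ℝ :=
  (∫ t in Ioi (0 : ℝ), ν {ω | t ≤ Z ω}) + ∫ t in Iic (0 : ℝ), (ν {ω | t ≤ Z ω} - ν univ)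

/-- The rank-dependent utility `∫ u(X) d(T ∘ P)`, in the sense of Choquet. -/
def rdu {Ω : Type*} [MeasurableSpace Ω] (P : Measure Ω) (u T : ℝ → ℝ) (X : Ω → ℝ) : ℝ :=
  choquet (fun A => T (P.real A)) (fun ω => u (X ω))

/-- The expected utility `∫ u(X) dP`. -/
def eu {Ω : Type*} [MeasurableSpace Ω] (P : Measure Ω) (u : ℝ → ℝ) (X : Ω → ℝ) : ℝ :=
  ∫ ω, u (X ω) ∂P

/-- The nudged weighting function `T_M(p) = (1 - f(M)) T(p) + f(M) p`. -/
def nudged (T f : ℝ → ℝ) (M p : ℝ) : ℝ := (1 - f M) * T p + f M * p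

/-- Feasible allocations: pairs of essentially bounded random variables that add up (almost
surely) to the constant `c`. -/
def Feasible {Ω : Type*} [MeasurableSpace Ω] (P : Measure Ω) (c : ℝ) (X₁ X₂ : Ω → ℝ) : Prop :=
  MemLp X₁ ⊤ P ∧ MemLp X₂ ⊤ P ∧ ∀ᵐ ω ∂P, X₁ ω + X₂ ω = c

/-- `(X₁, X₂)` solves `sup {U₁(X₁, T) + lam * U₂(X₂) : X₁ + X₂ = c}`: it is feasible and no
feasible allocation has larger welfare. -/
def Solves {Ω : Type*} [MeasurableSpace Ω] (P : Measure Ω) (u₁ u₂ T : ℝ → ℝ) (lam c : ℝ)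
    (X₁ X₂ : Ω → ℝ) : Prop :=
  Feasible P c X₁ X₂ ∧ ∀ Y₁ Y₂ : Ω → ℝ, Feasible P c Y₁ Y₂ →
    rdu P u₁ T Y₁ + lam * eu P u₂ Y₂ ≤ rdu P u₁ T X₁ + lam * eu P u₂ X₂

/-- The conjugate `t ↦ 1 - T(1 - t)`. -/
def conj (T : ℝ → ℝ) (t : ℝ) : ℝ := 1 - T (1 - t)

/-- The convex envelope on `[0,1]`: the pointwise supremum of all functions that are convex
on `[0,1]` and lie below `g` on `[0,1]` (of interest at points of `[0,1]` only). -/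
def convexEnvelope (g : ℝ → ℝ) (t : ℝ) : ℝ :=
  sSup {y | ∃ h : ℝ → ℝ, ConvexOn ℝ (Icc 0 1) h ∧ (∀ s ∈ Icc (0 : ℝ) 1, h s ≤ g s) ∧ y = h t}

/-- The derivative `δ'` of the convex envelope `δ` of the conjugate of `T`. -/
def delta' (T : ℝ → ℝ) (p : ℝ) : ℝ := deriv (convexEnvelope (conj T)) p

/-- `φ_M(p) = δ'(p) - f(M) (δ'(p) - 1)`. -/
def phi (T f : ℝ → ℝ) (M p : ℝ) : ℝ := delta' T p - f M * (delta' T p - 1)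

/-- `m(x) = lam * u₂'(w - M - x) / u₁'(x)`. -/
def m (u₁ u₂ : ℝ → ℝ) (lam w M x : ℝ) : ℝ := lam * (deriv u₂ (w - M - x) / deriv u₁ x)

/-- The inverse of `m(·)` at effort level `M`; meaningful on the range of `m`. -/
def mInv (u₁ u₂ : ℝ → ℝ) (lam w M y : ℝ) : ℝ := Function.invFun (m u₁ u₂ lam w M) y

/-- The sharing rule `x_M(p) = m⁻¹(φ_M(p))`; meaningful if `φ_M(p)` is in the range of `m`. -/
def share (u₁ u₂ T f : ℝ → ℝ) (lam w M p : ℝ) : ℝ := mInv u₁ u₂ lam w M (phi T f M p)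

/-- `Λ(y) = m'(m⁻¹(y))` at effort level `M`. -/
def Lam (u₁ u₂ : ℝ → ℝ) (lam w M y : ℝ) : ℝ :=
  deriv (m u₁ u₂ lam w M) (mInv u₁ u₂ lam w M y)

end Nudging

end

/-! The problem is reduced to a pointwise maximization. Put `Δ p = (1 - f M) δ(p) + f M p`, a convex
minorant of the conjugate of `T_M` with derivative `φ_M`. On a nonatomic space every `X₁` is sorted
by some uniform `U` (`IsNonatomic.exists_sortedBy`). A layer-cake formula then writes the Choquet
integral, up to a constant, as an integral over levels `t` of `T_M (1 - q)`, where `q` is the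
probability that `u₁(X₁)` is below `t`. Since `T_M (1 - q) ≤ 1 - Δ q`, and `1 - Δ q` is the integral
of `φ_M(U)` over `{q ≤ U}`, the rank-dependent utility is at most `E[φ_M(U) u₁(X₁)]`
(`IsDualDistortion.rdu_le`).

Welfare is therefore at most the expectation of `d u₁(x) + lam u₂(c - x)` at `d = φ_M(U)`, `x = X₁`.
Maximizing over `x` in a bounded interval for each `d` gives a bound that depends only on the law of
`U`. The maximizer is nondecreasing in `d`, hence constant wherever `φ_M` is. As `φ_M` is locally
constant wherever `Δ` lies strictly below the conjugate, the events on which the maximizer takes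
values in a lower set have probabilities at which the two agree (`IsDualDistortion.contact`), so the
bound is attained. By strict concavity the solutions are exactly the pointwise maximizers, that is,
the solutions of `m(X₁) = φ_M(U)` (`IsDualDistortion.solves_iff`).

Differentiability of `δ` holds because a convex function touching a differentiable one from below
has no kink, and away from contact `δ` is locally affine. The sensitivity in `M` comes from
inverting `(N, x) ↦ (N, m_N(x))` and following the curve `N ↦ (N, φ_N(p))`. -/

namespace Nudging

open Filter Topology
open scoped ENNReal

/-! ### The marginal rate `m`, its inverse, and sensitivity in the effort level -/

noncomputable section Calculus

variable {u u₁ u₂ : ℝ → ℝ} {lam w M x y : ℝ}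

lemma IsUtility.strictAnti_deriv (hu : IsUtility u) : StrictAnti (deriv u) :=
  strictAntiOn_univ.1 (hu.strictConcave.strictAntiOn_deriv fun x _ => hu.differentiable x)

lemma IsUtility.deriv_pos (hu : IsUtility u) (x : ℝ) : 0 < deriv u x :=
  (hu.mono.deriv_nonneg (x := x + 1)).trans_lt (hu.strictAnti_deriv (by linarith))

lemma IsUtility.strictMono (hu : IsUtility u) : StrictMono u :=
  strictMono_of_deriv_pos hu.deriv_pos

lemma IsUtility.continuous_deriv (hu : IsUtility u) : Continuous (deriv u) :=
  hu.differentiable_deriv.continuous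

lemma strictMono_m (hu₁ : IsUtility u₁) (hu₂ : IsUtility u₂) (hlam : 0 < lam) (w M : ℝ) :
    StrictMono (m u₁ u₂ lam w M) := by
  intro x y hxy
  have h1 := hu₁.strictAnti_deriv hxy
  have h2 : deriv u₂ (w - M - x) < deriv u₂ (w - M - y) := hu₂.strictAnti_deriv (by linarith)
  exact mul_lt_mul_of_pos_left
    (div_lt_div₀ h2 h1.le (hu₂.deriv_pos _).le (hu₁.deriv_pos _)) hlam

lemma mInv_m (hu₁ : IsUtility u₁) (hu₂ : IsUtility u₂) (hlam : 0 < lam) (w M x : ℝ) :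
    mInv u₁ u₂ lam w M (m u₁ u₂ lam w M x) = x :=
  Function.leftInverse_invFun (strictMono_m hu₁ hu₂ hlam w M).injective x

/-- The partial derivative of `m` with respect to its argument. -/
def mSlope (u₁ u₂ : ℝ → ℝ) (lam w M x : ℝ) : ℝ :=
  -lam / deriv u₁ x * (deriv (deriv u₂) (w - M - x) +
    deriv u₂ (w - M - x) * (deriv (deriv u₁) x / deriv u₁ x))

lemma hasDerivAt_m (hu₁ : IsUtility u₁) (hu₂ : IsUtility u₂) (lam w M x : ℝ) :
    HasDerivAt (m u₁ u₂ lam w M) (mSlope u₁ u₂ lam w M x) x := by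
  have h1 := (hu₁.differentiable_deriv x).hasDerivAt
  have h2 : HasDerivAt (fun x => deriv u₂ (w - M - x)) (deriv (deriv u₂) (w - M - x) * -1) x :=
    (hu₂.differentiable_deriv (w - M - x)).hasDerivAt.comp x ((hasDerivAt_id x).const_sub (w - M))
  have h3 := (h2.div h1 (hu₁.deriv_pos x).ne').const_mul lam
  convert! h3 using 1
  have := (hu₁.deriv_pos x).ne'
  simp only [mSlope]
  field_simp
  ring

lemma Lam_eq (hu₁ : IsUtility u₁) (hu₂ : IsUtility u₂) (lam w M y : ℝ) :
    Lam u₁ u₂ lam w M y = mSlope u₁ u₂ lam w M (mInv u₁ u₂ lam w M y) :=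
  (hasDerivAt_m hu₁ hu₂ lam w M _).deriv

/-- The graph map `(N, x) ↦ (N, m_N(x))`. -/
def graphMap (u₁ u₂ : ℝ → ℝ) (lam w : ℝ) (q : ℝ × ℝ) : ℝ × ℝ := (q.1, m u₁ u₂ lam w q.1 q.2)

/-- The inverse `(N, y) ↦ (N, m_N⁻¹(y))` of the graph map. -/
def graphInv (u₁ u₂ : ℝ → ℝ) (lam w : ℝ) (q : ℝ × ℝ) : ℝ × ℝ := (q.1, mInv u₁ u₂ lam w q.1 q.2)

lemma graphInv_graphMap (hu₁ : IsUtility u₁) (hu₂ : IsUtility u₂) (hlam : 0 < lam) (w : ℝ)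
    (q : ℝ × ℝ) : graphInv u₁ u₂ lam w (graphMap u₁ u₂ lam w q) = q := by
  simp [graphInv, graphMap, mInv_m hu₁ hu₂ hlam]

/-- The shear `(N, x) ↦ (N, b N + a x)` of the plane, for `a ≠ 0`. -/
def shear (a b : ℝ) (ha : a ≠ 0) : (ℝ × ℝ) ≃L[ℝ] ℝ × ℝ :=
  ContinuousLinearEquiv.equivOfInverse
    ((ContinuousLinearMap.fst ℝ ℝ ℝ).prod
      (b • ContinuousLinearMap.fst ℝ ℝ ℝ + a • ContinuousLinearMap.snd ℝ ℝ ℝ))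
    ((ContinuousLinearMap.fst ℝ ℝ ℝ).prod
      (a⁻¹ • (ContinuousLinearMap.snd ℝ ℝ ℝ - b • ContinuousLinearMap.fst ℝ ℝ ℝ)))
    (fun q => by ext <;> simp; field_simp) (fun q => by ext <;> simp; field_simp; ring)

lemma shear_symm_apply (a b : ℝ) (ha : a ≠ 0) (q : ℝ × ℝ) :
    (shear a b ha).symm q = (q.1, a⁻¹ * (q.2 - b * q.1)) := rfl

/-- The Jacobian is triangular because the first coordinate is kept, so nonvanishing of the slope in
`x` alone makes it invertible; the off-diagonal entry is `∂m/∂M`. -/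
lemma hasFDerivAt_graphMap (hu₁ : IsUtility u₁) (hu₂ : IsUtility u₂)
    (ha : mSlope u₁ u₂ lam w M x ≠ 0) :
    HasFDerivAt (graphMap u₁ u₂ lam w)
      (shear (mSlope u₁ u₂ lam w M x) (-lam * (deriv (deriv u₂) (w - M - x) / deriv u₁ x)) ha :
        (ℝ × ℝ) →L[ℝ] ℝ × ℝ) (M, x) := by
  have hd1 : HasFDerivAt (fun q : ℝ × ℝ => q.1) (ContinuousLinearMap.fst ℝ ℝ ℝ) (M, x) :=
    hasFDerivAt_fst
  have hd2 : HasFDerivAt (fun q : ℝ × ℝ => q.2) (ContinuousLinearMap.snd ℝ ℝ ℝ) (M, x) :=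
    hasFDerivAt_snd
  have h1 := (hu₁.differentiable_deriv x).hasDerivAt.comp_hasFDerivAt_of_eq (M, x) hd2 rfl
  have h2 := (hu₂.differentiable_deriv (w - M - x)).hasDerivAt.comp_hasFDerivAt_of_eq (M, x)
    ((hd1.const_sub w).sub hd2) rfl
  have h3 := (hasDerivAt_inv (hu₁.deriv_pos x).ne').comp_hasFDerivAt_of_eq (M, x) h1 rfl
  have h4 := (h2.mul h3).const_mul lam
  have hpos := (hu₁.deriv_pos x).ne'
  have h5 : HasFDerivAt (fun q : ℝ × ℝ => m u₁ u₂ lam w q.1 q.2) _ (M, x) := h4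
  refine (hd1.prodMk h5).congr_fderiv ?_
  refine ContinuousLinearMap.ext fun q => Prod.ext rfl ?_
  simp [shear, mSlope]
  field_simp
  ring

lemma contDiff_graphMap (hu₁ : IsUtility u₁) {k : ℕ∞} (h1 : ContDiff ℝ (k + 1) u₁)
    (h2 : ContDiff ℝ (k + 1) u₂) (lam w : ℝ) : ContDiff ℝ k (graphMap u₁ u₂ lam w) := by
  have h1' := (contDiff_succ_iff_deriv.1 h1).2.2
  have h2' := (contDiff_succ_iff_deriv.1 h2).2.2
  have e1 : ContDiff ℝ k (fun q : ℝ × ℝ => deriv u₁ q.2) := h1'.comp contDiff_snd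
  have e2 : ContDiff ℝ k (fun q : ℝ × ℝ => deriv u₂ (w - q.1 - q.2)) :=
    h2'.comp ((contDiff_const.sub contDiff_fst).sub contDiff_snd)
  exact contDiff_fst.prodMk (contDiff_const.mul (e2.div e1 fun q => (hu₁.deriv_pos q.2).ne'))

lemma continuous_m (u₁ : ℝ → ℝ) (hu₂ : IsUtility u₂) (lam w x : ℝ) :
    Continuous fun N => m u₁ u₂ lam w N x := by
  have := hu₂.continuous_deriv
  unfold m
  fun_prop

/-- Strict monotonicity gives strict inequalities at `x ± ε`; these persist for nearby `(N, y)`, and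
the intermediate value theorem does the rest. This yields both continuity of the inverse and the
fact that nearby values stay in the range, outside of which `mInv` is meaningless. -/
lemma eventually_bracket (hu₁ : IsUtility u₁) (hu₂ : IsUtility u₂) (hlam : 0 < lam)
    (w M x : ℝ) {ε : ℝ} (hε : 0 < ε) :
    ∀ᶠ q : ℝ × ℝ in 𝓝 (M, m u₁ u₂ lam w M x),
      ∃ z, x - ε < z ∧ z < x + ε ∧ m u₁ u₂ lam w q.1 z = q.2 := by
  have hm := strictMono_m hu₁ hu₂ hlam w M
  have hl : ∀ᶠ q : ℝ × ℝ in 𝓝 (M, m u₁ u₂ lam w M x), m u₁ u₂ lam w q.1 (x - ε) < q.2 :=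
    ((continuous_m u₁ hu₂ lam w (x - ε)).comp continuous_fst).continuousAt.eventually_lt
      continuous_snd.continuousAt (hm (by linarith))
  have hr : ∀ᶠ q : ℝ × ℝ in 𝓝 (M, m u₁ u₂ lam w M x), q.2 < m u₁ u₂ lam w q.1 (x + ε) :=
    continuous_snd.continuousAt.eventually_lt
      ((continuous_m u₁ hu₂ lam w (x + ε)).comp continuous_fst).continuousAt (hm (by linarith))
  filter_upwards [hl, hr] with q h1 h2
  have hc : ContinuousOn (m u₁ u₂ lam w q.1) (Icc (x - ε) (x + ε)) := fun z _ =>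
    (hasDerivAt_m hu₁ hu₂ lam w q.1 z).continuousAt.continuousWithinAt
  obtain ⟨z, hz, hzq⟩ := intermediate_value_Ioo (by linarith) hc ⟨h1, h2⟩
  exact ⟨z, hz.1, hz.2, hzq⟩

lemma continuousAt_graphInv (hu₁ : IsUtility u₁) (hu₂ : IsUtility u₂) (hlam : 0 < lam)
    (w M x : ℝ) : ContinuousAt (graphInv u₁ u₂ lam w) (M, m u₁ u₂ lam w M x) := by
  refine continuousAt_fst.prodMk (Metric.tendsto_nhds.2 fun ε hε => ?_)
  filter_upwards [eventually_bracket hu₁ hu₂ hlam w M x hε] with q hq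
  obtain ⟨z, h1, h2, hz⟩ := hq
  rw [← hz, mInv_m hu₁ hu₂ hlam, mInv_m hu₁ hu₂ hlam, Real.dist_eq, abs_lt]
  constructor <;> linarith

/-- The second derivatives of the utilities need not be continuous, so strict differentiability is
not available for the inverse function theorem. Differentiability at the single point suffices once
the inverse is known to be continuous there, and monotonicity supplies that. -/
lemma hasFDerivAt_graphInv (hu₁ : IsUtility u₁) (hu₂ : IsUtility u₂) (hlam : 0 < lam)
    (ha : mSlope u₁ u₂ lam w M x ≠ 0) :
    HasFDerivAt (graphInv u₁ u₂ lam w)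
      ((shear (mSlope u₁ u₂ lam w M x)
        (-lam * (deriv (deriv u₂) (w - M - x) / deriv u₁ x)) ha).symm :
        (ℝ × ℝ) →L[ℝ] ℝ × ℝ) (M, m u₁ u₂ lam w M x) := by
  refine HasFDerivAt.of_local_left_inverse (continuousAt_graphInv hu₁ hu₂ hlam w M x) ?_ ?_
    (f := graphMap u₁ u₂ lam w)
  · simpa only [graphInv, mInv_m hu₁ hu₂ hlam] using hasFDerivAt_graphMap hu₁ hu₂ ha
  · filter_upwards [eventually_bracket hu₁ hu₂ hlam w M x one_pos] with q hq
    obtain ⟨z, -, -, hz⟩ := hq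
    simp only [graphMap, graphInv]
    rw [← hz, mInv_m hu₁ hu₂ hlam, hz]

/-- Here the inverse function theorem applies; its local inverse agrees with `graphInv` near the
point because `graphInv` is a left inverse everywhere. -/
lemma contDiffAt_graphInv (hu₁ : IsUtility u₁) (hu₂ : IsUtility u₂) (hlam : 0 < lam)
    {k : ℕ∞} (hk : 1 ≤ k) (h1 : ContDiff ℝ (k + 1) u₁) (h2 : ContDiff ℝ (k + 1) u₂)
    (ha : mSlope u₁ u₂ lam w M x ≠ 0) :
    ContDiffAt ℝ k (graphInv u₁ u₂ lam w) (M, m u₁ u₂ lam w M x) := by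
  have hk0 : ((k : ℕ∞) : WithTop ℕ∞) ≠ 0 := by
    simpa using (zero_lt_one.trans_le hk).ne'
  have hc := (contDiff_graphMap hu₁ h1 h2 lam w).contDiffAt (x := (M, x))
  have hd := hasFDerivAt_graphMap (lam := lam) (w := w) (M := M) (x := x) hu₁ hu₂ ha
  refine (hc.to_localInverse hd hk0).congr_of_eventuallyEq ?_
  exact (hc.hasStrictFDerivAt' hd hk0).localInverse_unique
    (Eventually.of_forall (graphInv_graphMap hu₁ hu₂ hlam w))

variable {T f : ℝ → ℝ} {s : Set ℝ} {p : ℝ}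

/-- The share is the second coordinate of `graphInv` along `N ↦ (N, φ_N(p))`, so this is the chain
rule: the numerator is the derivative of `φ_N(p)` minus `∂m/∂M`. -/
lemma hasDerivWithinAt_share (hu₁ : IsUtility u₁) (hu₂ : IsUtility u₂) (hlam : 0 < lam)
    (hφ : phi T f M p ∈ range (m u₁ u₂ lam w M))
    (hL : Lam u₁ u₂ lam w M (phi T f M p) ≠ 0) (hf : DifferentiableWithinAt ℝ f s M) :
    HasDerivWithinAt (fun N => share u₁ u₂ T f lam w N p)
      ((-derivWithin f s M * (delta' T p - 1) +
        lam * (deriv (deriv u₂) (w - M - mInv u₁ u₂ lam w M (phi T f M p)) /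
          deriv u₁ (mInv u₁ u₂ lam w M (phi T f M p)))) /
        Lam u₁ u₂ lam w M (phi T f M p)) s M := by
  obtain ⟨x, hx⟩ := hφ
  rw [Lam_eq hu₁ hu₂, ← hx, mInv_m hu₁ hu₂ hlam] at hL
  rw [Lam_eq hu₁ hu₂, ← hx, mInv_m hu₁ hu₂ hlam]
  have hφd : HasDerivWithinAt (fun N => phi T f N p)
      (-(derivWithin f s M * (delta' T p - 1))) s M :=
    (hf.hasDerivWithinAt.mul_const _).const_sub _
  have hq := (hasDerivWithinAt_id M s).prodMk hφd
  have hK := hasFDerivAt_graphInv (lam := lam) (w := w) hu₁ hu₂ hlam hL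
  rw [hx] at hK
  have := (hasFDerivAt_snd.comp _ hK).comp_hasDerivWithinAt M hq
  convert! this using 1
  simp [shear_symm_apply]
  field_simp

lemma contDiffWithinAt_share (hu₁ : IsUtility u₁) (hu₂ : IsUtility u₂) (hlam : 0 < lam)
    (hφ : phi T f M p ∈ range (m u₁ u₂ lam w M))
    (hL : Lam u₁ u₂ lam w M (phi T f M p) ≠ 0) {k : ℕ∞} (hk : 1 ≤ k)
    (h1 : ContDiff ℝ (k + 1) u₁) (h2 : ContDiff ℝ (k + 1) u₂) (hf : ContDiffWithinAt ℝ k f s M) :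
    ContDiffWithinAt ℝ k (fun N => share u₁ u₂ T f lam w N p) s M := by
  obtain ⟨x, hx⟩ := hφ
  rw [Lam_eq hu₁ hu₂, ← hx, mInv_m hu₁ hu₂ hlam] at hL
  have hφc : ContDiffWithinAt ℝ k (fun N => phi T f N p) s M :=
    contDiffWithinAt_const.sub (hf.mul contDiffWithinAt_const)
  have hK := contDiffAt_graphInv (lam := lam) (w := w) hu₁ hu₂ hlam hk h1 h2 hL
  rw [hx] at hK
  exact (contDiffAt_snd.comp _ hK).comp_contDiffWithinAt M (contDiffWithinAt_id.prodMk hφc)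

end Calculus

/-! ### Uniform random variables that sort a given one -/

section Rank

variable {Ω : Type*} [MeasurableSpace Ω] {P : Measure Ω}

/-- On a nonatomic probability space there is a random variable with atomless law. -/
lemma IsNonatomic.exists_null_fibers [IsProbabilityMeasure P] (hP : IsNonatomic P) :
    ∃ V : Ω → ℝ, Measurable V ∧ ∀ a, P {ω | V ω = a} = 0 := by
  -- `D V` is the probability that two independent draws collide under `V`. A minimizer of `D` has
  -- no atoms, since splitting an atom would lower `D`.
  set D : (Ω → ℝ) → ℝ≥0∞ := fun V => (P.prod P) {p | V p.1 = V p.2} with hD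
  obtain ⟨x, -, hx, hxS⟩ := exists_seq_tendsto_sInf (S := D '' {V | Measurable V})
    ⟨_, _, measurable_const (a := (0 : ℝ)), rfl⟩ ⟨0, fun _ _ => zero_le⟩
  choose V hV hVx using hxS
  obtain ⟨e, he⟩ := exists_measurableEmbedding_real (ℕ → ℝ)
  obtain ⟨e', he'⟩ := exists_measurableEmbedding_real (ℝ × ℝ)
  -- The whole minimizing sequence is coded into one real variable: a collision of `W` is a
  -- collision of every `V n`, so the infimum is attained.
  set W : Ω → ℝ := fun ω => e fun n => V n ω with hW
  have hWm : Measurable W := he.measurable.comp (measurable_pi_iff.2 hV)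
  have hWmin : ∀ W', Measurable W' → D W ≤ D W' := by
    intro W' hW'
    have h1 : D W ≤ sInf (D '' {V | Measurable V}) := by
      refine ge_of_tendsto' hx fun n => ?_
      rw [← hVx n]
      exact measure_mono fun p hp => congrFun (he.injective hp) n
    exact h1.trans (sInf_le ⟨W', hW', rfl⟩)
  refine ⟨W, hWm, fun a => ?_⟩
  by_contra hne
  have hA : MeasurableSet {ω | W ω = a} := hWm (measurableSet_singleton a)
  obtain ⟨B, hBA, hB, hB0, hBlt⟩ := hP _ hA (pos_iff_ne_zero.2 hne)
  set A := {ω | W ω = a}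
  -- Recording membership in `B` removes the collisions in `B ×ˢ (A \ B)`, a set of positive
  -- measure.
  set W' : Ω → ℝ := fun ω => e' (W ω, B.indicator 1 ω) with hW'
  have hW'm : Measurable W' :=
    he'.measurable.comp (hWm.prodMk (measurable_one.indicator hB))
  have hdiff : 0 < P (A \ B) := by
    rw [measure_sdiff hBA hB.nullMeasurableSet (measure_ne_top P B)]
    exact tsub_pos_of_lt hBlt
  have hsub : {p : Ω × Ω | W' p.1 = W' p.2} ∪ B ×ˢ (A \ B) ⊆ {p | W p.1 = W p.2} := by
    rintro p (hp | hp)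
    · exact (Prod.ext_iff.1 (he'.injective hp)).1
    · have h1 : W p.1 = a := hBA hp.1
      have h2 : W p.2 = a := hp.2.1
      exact h1.trans h2.symm
  have hdisj : Disjoint {p : Ω × Ω | W' p.1 = W' p.2} (B ×ˢ (A \ B)) := by
    rw [Set.disjoint_left]
    intro p hp hpB
    have := (Prod.ext_iff.1 (he'.injective hp)).2
    simp [Set.indicator_of_mem hpB.1, Set.indicator_of_notMem hpB.2.2] at this
  have hle : D W' + P B * P (A \ B) ≤ D W := by
    rw [← Measure.prod_prod, hD]
    simp only
    rw [← measure_union hdisj (hB.prod (hA.diff hB))]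
    exact measure_mono hsub
  have hlt : D W' < D W' + P B * P (A \ B) :=
    ENNReal.lt_add_right (measure_ne_top _ _) (mul_ne_zero hB0.ne' hdiff.ne')
  exact absurd (hWmin W' hW'm) (not_le.2 (hlt.trans_le hle))

/-- If all initial segments of points of `L` with respect to a measurable total preorder have
measure at most `c`, then so has `L`. -/
lemma measure_le_of_initial_segments [IsProbabilityMeasure P]
    {r : Ω → Ω → Prop} (hr : MeasurableSet {p : Ω × Ω | r p.1 p.2})
    (htot : ∀ a b, r a b ∨ r b a) (htrans : ∀ a b c, r a b → r b c → r a c)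
    {L : Set Ω} (hL : MeasurableSet L) {c : ℝ≥0∞} (hc : ∀ ω ∈ L, P {a | r a ω} ≤ c) :
    P L ≤ c := by
  rcases L.eq_empty_or_nonempty with rfl | hne
  · simp
  have hseg : ∀ ω, MeasurableSet {a | r a ω} := fun ω =>
    (measurable_id.prodMk measurable_const : Measurable fun a : Ω => (a, ω)) hr
  set g : Ω → ℝ≥0∞ := fun ω => P (L ∩ {a | r a ω}) with hg
  -- The preorder need not have a countable cofinal subset, so segments along a sequence that
  -- exhausts the supremum of their measures are used; what they miss is shown to be null.
  obtain ⟨x, -, hx, hxS⟩ := exists_seq_tendsto_sSup (S := g '' L) (hne.image g)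
    ⟨⊤, fun _ _ => le_top⟩
  choose z hzL hzx using hxS
  set A : Set Ω := ⋃ n, L ∩ {a | r a (z n)} with hA
  have hAm : MeasurableSet A := MeasurableSet.iUnion fun n => hL.inter (hseg _)
  have hmono : ∀ {a b}, r a b → L ∩ {y | r y a} ⊆ L ∩ {y | r y b} := fun hab y hy =>
    ⟨hy.1, htrans _ _ _ hy.2 hab⟩
  have hdir : Directed (· ⊆ ·) fun n => L ∩ {a | r a (z n)} := by
    intro i j
    rcases htot (z i) (z j) with h | h
    · exact ⟨j, hmono h, subset_rfl⟩
    · exact ⟨i, subset_rfl, hmono h⟩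
  have hPA : P A = ⨆ n, g (z n) := hdir.measure_iUnion
  have hAc : P A ≤ c := by
    rw [hPA]
    exact iSup_le fun n => (measure_mono inter_subset_right).trans (hc _ (hzL n))
  have hsup : ∀ ω ∈ L, g ω ≤ P A := by
    intro ω hω
    refine (le_sSup (mem_image_of_mem g hω)).trans (le_of_tendsto' hx fun n => ?_)
    rw [← hzx n, hPA]
    exact le_iSup (fun n => g (z n)) n
  set R := L \ A with hR
  have hRm : MeasurableSet R := hL.diff hAm
  -- A point of `R` lies above all of `A`, so any mass of `R` below it would push its segment beyond
  -- the supremum `P A`.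
  have hR0 : ∀ ω ∈ R, P (R ∩ {a | r a ω}) = 0 := by
    intro ω hω
    have hsub : A ∪ R ∩ {a | r a ω} ⊆ L ∩ {a | r a ω} := by
      rintro a (ha | ha)
      · obtain ⟨n, hn⟩ := mem_iUnion.1 ha
        refine ⟨hn.1, (htot a ω).resolve_right fun h => hω.2 (mem_iUnion.2 ⟨n, hω.1, ?_⟩)⟩
        exact htrans _ _ _ h hn.2
      · exact ⟨ha.1.1, ha.2⟩
    have hd : Disjoint A (R ∩ {a | r a ω}) :=
      Set.disjoint_left.2 fun a ha ha' => ha'.1.2 ha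
    have h1 := (measure_mono hsub).trans (hsup ω hω.1)
    rw [measure_union hd (hRm.inter (hseg ω))] at h1
    by_contra h0
    exact absurd h1 (not_le.2 (ENNReal.lt_add_right (measure_ne_top _ _) h0))
  -- By totality `R ×ˢ R` is the union of the halves `r a b` and `r b a`, and each has null
  -- sections.
  have hprod : (P.prod P) (R ×ˢ R) = 0 := by
    have hswap : MeasurableSet {p : Ω × Ω | r p.2 p.1} := measurable_swap hr
    have h1 : (P.prod P) (R ×ˢ R ∩ {p | r p.1 p.2}) = 0 := by
      rw [Measure.prod_apply_symm ((hRm.prod hRm).inter hr)]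
      refine (lintegral_congr fun ω => ?_).trans lintegral_zero
      by_cases hω : ω ∈ R
      · refine measure_mono_null (fun a ha => ?_) (hR0 ω hω)
        exact ⟨ha.1.1, ha.2⟩
      · refine measure_mono_null (fun a ha => ?_) measure_empty
        exact hω ha.1.2
    have h2 : (P.prod P) (R ×ˢ R ∩ {p | r p.2 p.1}) = 0 := by
      rw [Measure.prod_apply ((hRm.prod hRm).inter hswap)]
      refine (lintegral_congr fun ω => ?_).trans lintegral_zero
      by_cases hω : ω ∈ R
      · refine measure_mono_null (fun a ha => ?_) (hR0 ω hω)
        exact ⟨ha.1.2, ha.2⟩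
      · refine measure_mono_null (fun a ha => ?_) measure_empty
        exact hω ha.1.1
    refine measure_mono_null (fun p hp => ?_) (measure_union_null h1 h2)
    exact (htot p.1 p.2).imp (fun h => ⟨hp, h⟩) fun h => ⟨hp, h⟩
  have hPR : P R = 0 := by simpa [Measure.prod_prod] using hprod
  calc P L ≤ P (A ∪ R) := measure_mono fun a ha => by
        by_cases h : a ∈ A
        exacts [Or.inl h, Or.inr ⟨ha, h⟩]
    _ ≤ P A + P R := measure_union_le _ _
    _ ≤ c := by rw [hPR, add_zero]; exact hAc

/-- The rank of a point in a measurable total preorder with null equivalence classes is uniformly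
distributed. -/
lemma map_rank_eq [IsProbabilityMeasure P]
    {r : Ω → Ω → Prop} (hr : MeasurableSet {p : Ω × Ω | r p.1 p.2})
    (htot : ∀ a b, r a b ∨ r b a) (htrans : ∀ a b c, r a b → r b c → r a c)
    (hnull : ∀ ω, P {a | r a ω ∧ r ω a} = 0) :
    Measurable (fun ω => P.real {a | r a ω}) ∧
      P.map (fun ω => P.real {a | r a ω}) = volume.restrict (Ioo 0 1) := by
  have hswap : MeasurableSet {p : Ω × Ω | r p.2 p.1} := measurable_swap hr
  have hU : Measurable fun ω => P.real {a | r a ω} :=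
    (measurable_measure_prodMk_left hswap).ennreal_toReal
  have hseg : ∀ ω, MeasurableSet {a | r a ω} := fun ω =>
    (measurable_id.prodMk measurable_const : Measurable fun a : Ω => (a, ω)) hr
  refine ⟨hU, ?_⟩
  have : IsFiniteMeasure (P.map fun ω => P.real {a | r a ω}) := inferInstance
  refine Measure.ext_of_Iic _ _ fun u => ?_
  rw [Measure.map_apply hU measurableSet_Iic, Measure.restrict_congr_set Ioo_ae_eq_Ioc,
    Measure.restrict_apply measurableSet_Iic, inter_comm, Ioc_inter_Iic, Real.volume_Ioc, sub_zero]
  rcases lt_or_ge u 0 with hu0 | hu0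
  · rw [ENNReal.ofReal_of_nonpos (inf_le_right.trans hu0.le)]
    refine measure_mono_null (fun a ha => ?_) measure_empty
    exact absurd (measureReal_nonneg.trans (mem_Iic.1 ha)) (not_le.2 hu0)
  rcases le_or_gt 1 u with hu1 | hu1
  · rw [min_eq_left hu1, ENNReal.ofReal_one]
    convert! measure_univ (μ := P)
    exact eq_univ_of_forall fun a => measureReal_le_one.trans hu1
  rw [min_eq_right hu1.le]
  have hm : MeasurableSet ((fun ω => P.real {a | r a ω}) ⁻¹' Iic u) := hU measurableSet_Iic
  apply le_antisymm
  · refine measure_le_of_initial_segments hr htot htrans hm fun ω hω => ?_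
    rw [← ofReal_measureReal]
    exact ENNReal.ofReal_le_ofReal hω
  -- The reverse inequality is the same bound for the opposite preorder on the complement; null
  -- equivalence classes let final segments be complements of initial ones up to null sets.
  · have h1 : P ((fun ω => P.real {a | r a ω}) ⁻¹' Iic u)ᶜ ≤ ENNReal.ofReal (1 - u) := by
      refine measure_le_of_initial_segments (r := fun a b => r b a) hswap
        (fun a b => (htot a b).symm) (fun a b c h h' => htrans _ _ _ h' h) hm.compl fun ω hω => ?_
      have hω' : u < P.real {a | r a ω} := not_le.1 hω
      have hsub : {a | r ω a} ⊆ {a | r a ω}ᶜ ∪ {a | r a ω ∧ r ω a} := by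
        intro a ha
        by_cases h : r a ω
        exacts [Or.inr ⟨h, ha⟩, Or.inl h]
      refine (measure_mono hsub).trans ((measure_union_le _ _).trans ?_)
      rw [hnull ω, add_zero, ← ofReal_measureReal, probReal_compl_eq_one_sub (hseg ω)]
      exact ENNReal.ofReal_le_ofReal (by linarith)
    rw [← ofReal_measureReal, probReal_compl_eq_one_sub hm,
      ENNReal.ofReal_le_ofReal_iff (by linarith)] at h1
    rw [← ofReal_measureReal]
    exact ENNReal.ofReal_le_ofReal (by linarith)

/-- `X` is a nondecreasing transform of `U`, expressed through events: the event that `X` lies in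
a lower set is the event that `U` is below the probability of that event. -/
def SortedBy (P : Measure Ω) (X U : Ω → ℝ) : Prop :=
  ∀ S : Set ℝ, IsLowerSet S → {ω | X ω ∈ S} =ᵐ[P] {ω | U ω < P.real {ω | X ω ∈ S}}

/-- Preimages of lower sets under monotone maps are lower sets, which is why the definition ranges
over all lower sets rather than half-lines. -/
lemma SortedBy.comp {X U : Ω → ℝ} (h : SortedBy P X U) {g : ℝ → ℝ} (hg : Monotone g) :
    SortedBy P (fun ω => g (X ω)) U := fun S hS =>
  h (g ⁻¹' S) fun _ _ hab ha => hS (hg hab) ha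

lemma SortedBy.congr {X Y U : Ω → ℝ} (h : SortedBy P X U) (hXY : X =ᵐ[P] Y) :
    SortedBy P Y U := by
  intro S hS
  have h1 : {ω | Y ω ∈ S} =ᵐ[P] {ω | X ω ∈ S} := by
    filter_upwards [hXY] with ω hω
    exact propext (show Y ω ∈ S ↔ X ω ∈ S by rw [hω])
  have h2 : P.real {ω | Y ω ∈ S} = P.real {ω | X ω ∈ S} := measureReal_congr h1
  rw [h2]
  exact h1.trans (h S hS)

/-- The law of `U` evaluated on a half-line. -/
lemma measure_lt_of_uniform {U : Ω → ℝ} (hU : Measurable U)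
    (hmap : P.map U = volume.restrict (Ioo 0 1)) {q : ℝ} (hq0 : 0 ≤ q) (hq1 : q ≤ 1) :
    P.real {ω | U ω < q} = q := by
  have h : P {ω | U ω < q} = ENNReal.ofReal q := by
    have := Measure.map_apply (μ := P) hU (measurableSet_Iio (a := q))
    rw [hmap, Measure.restrict_congr_set (Ioo_ae_eq_Ico (a := (0 : ℝ)) (b := 1)),
      Measure.restrict_apply measurableSet_Iio, inter_comm, Ico_inter_Iio, Real.volume_Ico, sub_zero,
      min_eq_right hq1] at this
    exact this.symm
  rw [Measure.real, h, ENNReal.toReal_ofReal hq0]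

lemma ae_ne_of_uniform {U : Ω → ℝ} (hU : Measurable U)
    (hmap : P.map U = volume.restrict (Ioo 0 1)) (q : ℝ) : ∀ᵐ ω ∂P, U ω ≠ q := by
  have : ∀ᵐ x ∂(P.map U), x ≠ q := by
    rw [hmap]
    exact ae_restrict_of_ae (Measure.ae_ne volume q)
  exact ae_of_ae_map hU.aemeasurable this

lemma ae_mem_of_uniform {U : Ω → ℝ} (hU : Measurable U)
    (hmap : P.map U = volume.restrict (Ioo 0 1)) : ∀ᵐ ω ∂P, U ω ∈ Ioo (0 : ℝ) 1 := by
  have : ∀ᵐ x ∂(P.map U), x ∈ Ioo (0 : ℝ) 1 := by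
    rw [hmap]
    exact ae_restrict_mem measurableSet_Ioo
  exact ae_of_ae_map hU.aemeasurable this

/-- On a nonatomic space every random variable is a nondecreasing transform of a uniform one. -/
lemma IsNonatomic.exists_sortedBy [IsProbabilityMeasure P]
    (hP : IsNonatomic P) {X : Ω → ℝ} (hX : AEMeasurable X P) :
    ∃ U : Ω → ℝ, Measurable U ∧ P.map U = volume.restrict (Ioo 0 1) ∧ SortedBy P X U := by
  obtain ⟨V, hV, hV0⟩ := hP.exists_null_fibers
  set Y := hX.mk X
  have hY : Measurable Y := hX.measurable_mk
  -- Lexicographic order: the atomless `V` breaks the ties of `Y`, which makes equivalence classes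
  -- null.
  set r : Ω → Ω → Prop := fun a b => Y a < Y b ∨ Y a = Y b ∧ V a ≤ V b with hr
  have hrm : MeasurableSet {p : Ω × Ω | r p.1 p.2} := by
    have h1 : Measurable fun p : Ω × Ω => Y p.1 := hY.comp measurable_fst
    have h2 : Measurable fun p : Ω × Ω => Y p.2 := hY.comp measurable_snd
    have h3 : Measurable fun p : Ω × Ω => V p.1 := hV.comp measurable_fst
    have h4 : Measurable fun p : Ω × Ω => V p.2 := hV.comp measurable_snd
    exact (measurableSet_lt h1 h2).union
      ((measurableSet_eq_fun h1 h2).inter (measurableSet_le h3 h4))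
  have htot : ∀ a b, r a b ∨ r b a := by
    intro a b
    rcases lt_trichotomy (Y a) (Y b) with h | h | h
    · exact Or.inl (Or.inl h)
    · exact (le_total (V a) (V b)).imp (fun h' => Or.inr ⟨h, h'⟩) fun h' => Or.inr ⟨h.symm, h'⟩
    · exact Or.inr (Or.inl h)
  have htrans : ∀ a b c, r a b → r b c → r a c := by
    rintro a b c (h | ⟨h, h'⟩) (k | ⟨k, k'⟩)
    · exact Or.inl (h.trans k)
    · exact Or.inl (k ▸ h)
    · exact Or.inl (h ▸ k)
    · exact Or.inr ⟨h.trans k, h'.trans k'⟩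
  have hnull : ∀ ω, P {a | r a ω ∧ r ω a} = 0 := by
    intro ω
    refine measure_mono_null (fun a ha => ?_) (hV0 (V ω))
    rcases ha with ⟨h | ⟨h, h'⟩, k | ⟨k, k'⟩⟩
    · exact absurd h k.asymm
    · exact absurd k h.ne'
    · exact absurd h k.ne'
    · exact le_antisymm h' k'
  obtain ⟨hU, hmap⟩ := map_rank_eq hrm htot htrans hnull
  refine ⟨_, hU, hmap, SortedBy.congr ?_ hX.ae_eq_mk.symm⟩
  intro S hS
  set q := P.real {ω | Y ω ∈ S} with hq
  have hSm : MeasurableSet {ω | Y ω ∈ S} := hY hS.ordConnected.measurableSet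
  have hne := ae_ne_of_uniform hU hmap q
  have hlt : {ω | P.real {a | r a ω} < q} =ᵐ[P] {ω | P.real {a | r a ω} ≤ q} := by
    filter_upwards [hne] with ω hω
    exact propext ⟨fun h => le_of_lt h, fun h => lt_of_le_of_ne h hω⟩
  -- The event `Y ∈ S` is contained in the event that the rank is at most `q`, and both have
  -- probability `q`.
  refine (ae_eq_of_subset_of_measure_ge ?_ ?_ hSm.nullMeasurableSet (measure_ne_top _ _)).trans
    hlt.symm
  · intro ω hω
    refine measureReal_mono fun a ha => ?_
    rcases ha with h | h
    · exact hS h.le hω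
    · exact hS h.1.le hω
  · rw [← measure_congr hlt, ← ofReal_measureReal,
      measure_lt_of_uniform hU hmap measureReal_nonneg measureReal_le_one, ofReal_measureReal]

end Rank

/-! ### Regularity of the convex envelope -/

section Envelope

variable {g : ℝ → ℝ} {q t : ℝ}

/-- The functions whose convex envelope is considered: nonnegative on `[0,1]`, continuous there,
differentiable inside, with values `0` at `0` and `1` at `1`. -/
structure IsEnvelopable (g : ℝ → ℝ) : Prop where
  zero : g 0 = 0
  one : g 1 = 1
  nonneg : ∀ t ∈ Icc (0 : ℝ) 1, 0 ≤ g t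
  continuousOn : ContinuousOn g (Icc 0 1)
  differentiableAt : ∀ t ∈ Ioo (0 : ℝ) 1, DifferentiableAt ℝ g t

lemma le_convexEnvelope {h : ℝ → ℝ} (hh : ConvexOn ℝ (Icc 0 1) h)
    (hg : ∀ s ∈ Icc (0 : ℝ) 1, h s ≤ g s) (ht : t ∈ Icc (0 : ℝ) 1) : h t ≤ convexEnvelope g t :=
  le_csSup ⟨g t, by rintro _ ⟨h, -, hl, rfl⟩; exact hl t ht⟩ ⟨h, hh, hg, rfl⟩

lemma convexEnvelope_le_of (hg : ∀ s ∈ Icc (0 : ℝ) 1, 0 ≤ g s) {c : ℝ}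
    (hc : ∀ h : ℝ → ℝ, ConvexOn ℝ (Icc 0 1) h → (∀ s ∈ Icc (0 : ℝ) 1, h s ≤ g s) → h t ≤ c) :
    convexEnvelope g t ≤ c :=
  csSup_le ⟨0, fun _ => 0, convexOn_const 0 (convex_Icc 0 1), hg, rfl⟩
    (by rintro _ ⟨h, h1, h2, rfl⟩; exact hc h h1 h2)

namespace IsEnvelopable

lemma convexEnvelope_le (hg : IsEnvelopable g) (ht : t ∈ Icc (0 : ℝ) 1) :
    convexEnvelope g t ≤ g t :=
  convexEnvelope_le_of hg.nonneg fun _ _ h => h t ht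

lemma convexEnvelope_nonneg (hg : IsEnvelopable g) (ht : t ∈ Icc (0 : ℝ) 1) :
    0 ≤ convexEnvelope g t :=
  le_convexEnvelope (h := fun _ => 0) (convexOn_const 0 (convex_Icc 0 1)) hg.nonneg ht

lemma convexOn (hg : IsEnvelopable g) : ConvexOn ℝ (Icc 0 1) (convexEnvelope g) := by
  refine ⟨convex_Icc 0 1, fun x hx y hy a b ha hb hab => ?_⟩
  refine convexEnvelope_le_of hg.nonneg fun h h1 h2 => (h1.2 hx hy ha hb hab).trans ?_
  simp only [smul_eq_mul]
  gcongr
  · exact le_convexEnvelope h1 h2 hx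
  · exact le_convexEnvelope h1 h2 hy

lemma convexEnvelope_zero (hg : IsEnvelopable g) : convexEnvelope g 0 = 0 :=
  le_antisymm ((hg.convexEnvelope_le (by simp)).trans hg.zero.le)
    (hg.convexEnvelope_nonneg (by simp))

/-- A steep line of height `1 - ε` at `1` is a minorant: near `1` by continuity of `g`, farther away
because it is negative there. Such lines control the envelope at the right endpoint. -/
lemma exists_affine_le (hg : IsEnvelopable g) {ε : ℝ} (hε : 0 < ε) :
    ∃ K, ∀ t ∈ Icc (0 : ℝ) 1, 1 - ε - K * (1 - t) ≤ convexEnvelope g t := by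
  have h1 : ∀ᶠ s in 𝓝[Icc 0 1] (1 : ℝ), 1 - ε < g s :=
    (hg.continuousOn 1 (by simp)).eventually_const_lt (by rw [hg.one]; linarith)
  obtain ⟨η, hη, hb⟩ := Metric.mem_nhdsWithin_iff.1 h1
  refine ⟨1 / η, fun t ht => ?_⟩
  refine le_convexEnvelope (h := fun t => 1 - ε - 1 / η * (1 - t)) ?_ (fun s hs => ?_) ht
  · refine ⟨convex_Icc 0 1, fun x _ y _ a b _ _ hab => le_of_eq ?_⟩
    obtain rfl : b = 1 - a := by linarith
    simp only [smul_eq_mul]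
    ring
  · rcases lt_or_ge (1 - s) η with h | h
    · have h2 : 1 - ε < g s := hb ⟨by
        rw [Metric.mem_ball, Real.dist_eq, abs_lt]; constructor <;> linarith [hs.2], hs⟩
      have h3 : 0 ≤ 1 / η * (1 - s) := mul_nonneg (by positivity) (by linarith [hs.2])
      linarith
    · have h3 : 1 ≤ 1 / η * (1 - s) := by
        rw [one_div, ← div_eq_inv_mul, le_div_iff₀ hη]; linarith
      linarith [hg.nonneg s hs]

lemma convexEnvelope_one (hg : IsEnvelopable g) : convexEnvelope g 1 = 1 := by
  refine le_antisymm ((hg.convexEnvelope_le (by simp)).trans hg.one.le) ?_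
  refine le_of_forall_pos_le_add fun ε hε => ?_
  obtain ⟨K, hK⟩ := hg.exists_affine_le hε
  linarith [hK 1 (by simp)]

lemma continuousOn_convexEnvelope (hg : IsEnvelopable g) :
    ContinuousOn (convexEnvelope g) (Icc 0 1) := by
  intro t ht
  rcases eq_or_lt_of_le ht.1 with rfl | h0
  · have h1 := hg.continuousOn 0 ht
    rw [ContinuousWithinAt, hg.zero] at h1
    rw [ContinuousWithinAt, hg.convexEnvelope_zero]
    refine tendsto_of_tendsto_of_tendsto_of_le_of_le' tendsto_const_nhds h1 ?_ ?_
    · filter_upwards [self_mem_nhdsWithin] with s hs using hg.convexEnvelope_nonneg hs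
    · filter_upwards [self_mem_nhdsWithin] with s hs using hg.convexEnvelope_le hs
  rcases eq_or_lt_of_le ht.2 with rfl | h1
  · rw [ContinuousWithinAt, hg.convexEnvelope_one]
    refine tendsto_order.2 ⟨fun a ha => ?_, fun a ha => ?_⟩
    · obtain ⟨K, hK⟩ := hg.exists_affine_le (ε := (1 - a) / 2) (by linarith)
      have hc : ContinuousWithinAt (fun t : ℝ => 1 - (1 - a) / 2 - K * (1 - t)) (Icc 0 1) 1 := by
        fun_prop
      filter_upwards [self_mem_nhdsWithin, hc.eventually_const_lt (u := a) (by linarith)] with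
        s hs h
      exact h.trans_le (hK s hs)
    · filter_upwards [self_mem_nhdsWithin, (hg.continuousOn 1 ht).eventually_lt_const
        (by rwa [hg.one])] with s hs h
      exact (hg.convexEnvelope_le hs).trans_lt h
  · have := hg.convexOn.continuousOn_interior t (by rw [interior_Icc]; exact ⟨h0, h1⟩)
    rw [interior_Icc] at this
    exact (this.continuousAt (Ioo_mem_nhds h0 h1)).continuousWithinAt

/-- Where it is strictly below the function, the convex envelope is locally affine. -/
lemma eventually_affine (hg : IsEnvelopable g) (hq : q ∈ Ioo (0 : ℝ) 1)
    (hlt : convexEnvelope g q < g q) :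
    ∃ c d, ∀ᶠ r in 𝓝 q, convexEnvelope g r = c * r + d := by
  set E := convexEnvelope g with hE
  have hnhds : Icc (0 : ℝ) 1 ∈ 𝓝 q := Icc_mem_nhds hq.1 hq.2
  -- A level `z` separating the envelope from `g` near `q` leaves room for a chord of the envelope
  -- that still lies below `g`.
  obtain ⟨z, hz1, hz2⟩ := exists_between hlt
  have h1 : ∀ᶠ r in 𝓝 q, E r < z ∧ z < g r ∧ r ∈ Icc (0 : ℝ) 1 :=
    ((hg.continuousOn_convexEnvelope.continuousAt hnhds).eventually_lt_const hz1).and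
      (((hg.continuousOn.continuousAt hnhds).eventually_const_lt hz2).and hnhds)
  obtain ⟨η, hη, hb⟩ := Metric.eventually_nhds_iff_ball.1 h1
  have hmem : ∀ r ∈ Icc (q - η / 2) (q + η / 2), E r < z ∧ z < g r ∧ r ∈ Icc (0 : ℝ) 1 := by
    intro r hr
    refine hb r ?_
    rw [Metric.mem_ball, Real.dist_eq, abs_lt]
    constructor <;> linarith [hr.1, hr.2]
  set a := q - η / 2 with ha
  set b := q + η / 2 with hb'
  have hab : a < b := by linarith
  have haI := hmem a ⟨le_rfl, hab.le⟩
  have hbI := hmem b ⟨hab.le, le_rfl⟩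
  set s := (E b - E a) / (b - a) with hs
  have hsE : s * (b - a) = E b - E a := by
    rw [hs]; exact div_mul_cancel₀ _ (by linarith)
  set L : ℝ → ℝ := fun r => E a + s * (r - a) with hL
  have hinside : ∀ r ∈ Icc a b, E r ≤ L r ∧ L r < z := by
    intro r hr
    constructor
    · rcases eq_or_lt_of_le hr.1 with rfl | h
      · simp [hL]
      · have := hg.convexOn.secant_mono haI.2.2 (hmem r hr).2.2 hbI.2.2 h.ne' hab.ne' hr.2
        rw [div_le_iff₀ (by linarith)] at this
        simp only [hL]; linarith
    · have hu : L r = ((b - r) * E a + (r - a) * E b) / (b - a) := by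
        simp only [hL, hs]
        have : b - a ≠ 0 := by linarith
        field_simp
        ring
      rw [hu, div_lt_iff₀ (by linarith)]
      rcases eq_or_lt_of_le hr.1 with h | h
      · rw [← h]; nlinarith [haI.1]
      · nlinarith [mul_le_mul_of_nonneg_left haI.1.le (sub_nonneg.2 hr.2),
          mul_lt_mul_of_pos_left hbI.1 (sub_pos.2 h)]
  have houtside : ∀ r ∈ Icc (0 : ℝ) 1, r ∉ Icc a b → L r ≤ E r := by
    intro r hr hrn
    simp only [hL]
    rcases lt_or_ge r a with h | h
    · have := hg.convexOn.secant_mono haI.2.2 hr hbI.2.2 h.ne hab.ne' (h.trans hab).le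
      rw [div_le_iff_of_neg (by linarith)] at this
      linarith
    · have h' : b < r := lt_of_not_ge fun h' => hrn ⟨h, h'⟩
      have := hg.convexOn.secant_mono haI.2.2 hbI.2.2 hr hab.ne' (hab.trans h').ne' h'.le
      rw [le_div_iff₀ (by linarith)] at this
      linarith
  have hLc : ConvexOn ℝ (Icc 0 1) L := by
    refine ⟨convex_Icc 0 1, fun x _ y _ a b _ _ hab => le_of_eq ?_⟩
    obtain rfl : b = 1 - a := by linarith
    simp only [smul_eq_mul, hL]
    ring
  -- The chord dominates `E` only between `a` and `b`, where it stays below `z`. Thus `E ⊔ L` is a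
  -- convex minorant of `g`, and maximality of the envelope forces `E = L` on that interval.
  have hmax : ∀ r ∈ Icc (0 : ℝ) 1, (E ⊔ L) r ≤ g r := by
    intro r hr
    refine sup_le (hg.convexEnvelope_le hr) ?_
    by_cases hrn : r ∈ Icc a b
    · exact ((hinside r hrn).2.trans (hmem r hrn).2.1).le
    · exact (houtside r hr hrn).trans (hg.convexEnvelope_le hr)
  refine ⟨s, E a - s * a, ?_⟩
  filter_upwards [Icc_mem_nhds (show a < q by linarith) (show q < b by linarith)] with r hr
  have h2 : L r ≤ E r :=
    (le_sup_right (a := E r)).trans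
      (le_convexEnvelope (hg.convexOn.sup hLc) hmax (hmem r hr).2.2)
  rw [le_antisymm (hinside r hr).1 h2]
  simp only [hL]
  ring

/-- At a contact point, touching from below squeezes the slopes: right derivative `≤ g' ≤` left
derivative, while convexity gives the opposite order. Elsewhere the envelope is locally affine. -/
lemma differentiableAt_convexEnvelope (hg : IsEnvelopable g) (hq : q ∈ Ioo (0 : ℝ) 1) :
    DifferentiableAt ℝ (convexEnvelope g) q := by
  set E := convexEnvelope g with hE
  rcases (hg.convexEnvelope_le (Ioo_subset_Icc_self hq)).lt_or_eq with hlt | heq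
  · obtain ⟨c, d, h⟩ := hg.eventually_affine hq hlt
    have h1 : DifferentiableAt ℝ (fun r => c * r + d) q := by fun_prop
    exact h1.congr_of_eventuallyEq h
  have hint : q ∈ interior (Icc (0 : ℝ) 1) := by rwa [interior_Icc]
  have hr := hg.convexOn.hasDerivWithinAt_rightDeriv_of_mem_interior hint
  have hl := hg.convexOn.hasDerivWithinAt_leftDeriv_of_mem_interior hint
  have hlr := hg.convexOn.leftDeriv_le_rightDeriv_of_mem_interior hint
  have hgd := (hg.differentiableAt q hq).hasDerivAt
  set R := derivWithin (convexEnvelope g) (Ioi q) q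
  set L := derivWithin (convexEnvelope g) (Iio q) q
  have hI : ∀ᶠ r in 𝓝 q, r ∈ Icc (0 : ℝ) 1 := Icc_mem_nhds hq.1 hq.2
  have h1 : R ≤ deriv g q := by
    refine le_of_tendsto_of_tendsto ((hasDerivWithinAt_iff_tendsto_slope' (by simp)).1 hr)
      ((hasDerivWithinAt_iff_tendsto_slope' (by simp)).1 (hgd.hasDerivWithinAt (s := Ioi q))) ?_
    filter_upwards [self_mem_nhdsWithin, nhdsWithin_le_nhds hI] with r hr hrI
    rw [slope_def_field, slope_def_field, heq]
    have : 0 < r - q := sub_pos.2 hr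
    gcongr
    exact hg.convexEnvelope_le hrI
  have h2 : deriv g q ≤ L := by
    refine le_of_tendsto_of_tendsto
      ((hasDerivWithinAt_iff_tendsto_slope' (by simp)).1 (hgd.hasDerivWithinAt (s := Iio q)))
      ((hasDerivWithinAt_iff_tendsto_slope' (by simp)).1 hl) ?_
    filter_upwards [self_mem_nhdsWithin, nhdsWithin_le_nhds hI] with r hr hrI
    rw [slope_def_field, slope_def_field, heq]
    have : r - q < 0 := sub_neg.2 hr
    exact div_le_div_of_nonpos_of_le this.le (by linarith [hg.convexEnvelope_le hrI])
  have hLR : L = R := le_antisymm hlr (h1.trans h2)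
  rw [hLR] at hl
  have := hl.Iic_of_Iio.union hr.Ici_of_Ioi
  rw [Iic_union_Ici, hasDerivWithinAt_univ] at this
  exact this.differentiableAt

lemma monotoneOn_deriv (hg : IsEnvelopable g) :
    MonotoneOn (deriv (convexEnvelope g)) (Ioo 0 1) :=
  (hg.convexOn.subset Ioo_subset_Icc_self (convex_Ioo 0 1)).monotoneOn_deriv
    fun _ hx => hg.differentiableAt_convexEnvelope hx

lemma deriv_nonneg (hg : IsEnvelopable g) (hq : q ∈ Ioo (0 : ℝ) 1) :
    0 ≤ deriv (convexEnvelope g) q := by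
  have h := hg.convexOn.slope_le_of_hasDerivAt (x := 0) (by simp) (Ioo_subset_Icc_self hq) hq.1
    (hg.differentiableAt_convexEnvelope hq).hasDerivAt
  refine le_trans ?_ h
  rw [slope_def_field, hg.convexEnvelope_zero]
  have := hg.convexEnvelope_nonneg (Ioo_subset_Icc_self hq)
  have := hq.1
  simp only [sub_zero]
  positivity

lemma eventually_deriv_eq (hg : IsEnvelopable g) (hq : q ∈ Ioo (0 : ℝ) 1)
    (hlt : convexEnvelope g q < g q) :
    ∀ᶠ r in 𝓝 q, deriv (convexEnvelope g) r = deriv (convexEnvelope g) q := by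
  obtain ⟨c, d, h⟩ := hg.eventually_affine hq hlt
  have key : ∀ᶠ r in 𝓝 q, deriv (convexEnvelope g) r = c := by
    filter_upwards [h.eventually_nhds] with r hr
    rw [EventuallyEq.deriv_eq hr]
    simp
  filter_upwards [key] with r hr
  rw [hr, key.self_of_nhds]

end IsEnvelopable

end Envelope

/-! ### Convex minorants of the conjugate of the nudged weighting -/

section DualDistortion

/-- `Δ` is a convex minorant, with derivative `φ`, of the conjugate `t ↦ 1 - T(1 - t)`; it is
locally affine where it is strictly smaller. -/
structure IsDualDistortion (T Δ φ : ℝ → ℝ) : Prop where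
  zero : T 0 = 0
  one : T 1 = 1
  mono : MonotoneOn T (Icc 0 1)
  env_zero : Δ 0 = 0
  env_one : Δ 1 = 1
  continuousOn : ContinuousOn Δ (Icc 0 1)
  hasDerivAt : ∀ p ∈ Ioo (0 : ℝ) 1, HasDerivAt Δ (φ p) p
  monotoneOn : MonotoneOn φ (Ioo 0 1)
  nonneg : ∀ p ∈ Ioo (0 : ℝ) 1, 0 ≤ φ p
  le : ∀ q ∈ Icc (0 : ℝ) 1, T (1 - q) ≤ 1 - Δ q
  flat : ∀ q ∈ Ioo (0 : ℝ) 1, T (1 - q) < 1 - Δ q → ∀ᶠ r in 𝓝 q, φ r = φ q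

variable {T f : ℝ → ℝ} {w M : ℝ}

lemma IsWeighting.isEnvelopable_conj (hT : IsWeighting T) : IsEnvelopable (conj T) where
  zero := by simp [conj, hT.one]
  one := by simp [conj, hT.zero]
  nonneg t ht := by
    have : T (1 - t) ≤ T 1 := hT.strictMono.monotoneOn
      ⟨by linarith [ht.2], by linarith [ht.1]⟩ (by simp) (by linarith [ht.1])
    rw [hT.one] at this
    simp only [conj]
    linarith
  continuousOn := by
    refine continuousOn_const.sub (hT.continuousOn.comp (by fun_prop) fun t ht => ?_)
    exact ⟨by linarith [ht.2], by linarith [ht.1]⟩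
  differentiableAt t ht := by
    have hm : 1 - t ∈ Ioo (0 : ℝ) 1 := ⟨by linarith [ht.2], by linarith [ht.1]⟩
    have h1 : DifferentiableAt ℝ T (1 - t) :=
      (hT.differentiableOn _ hm).differentiableAt (Ioo_mem_nhds hm.1 hm.2)
    exact (h1.comp t ((differentiableAt_const 1).sub differentiableAt_id)).const_sub 1

/-- Mixing with the identity commutes with conjugation, so the same mixture of `δ` with the identity
serves as minorant, and a strict gap after mixing forces a strict gap before it. -/
lemma isDualDistortion_nudged (hT : IsWeighting T) (hM : f M ∈ Icc (0 : ℝ) 1) :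
    IsDualDistortion (nudged T f M)
      (fun p => (1 - f M) * convexEnvelope (conj T) p + f M * p) (phi T f M) := by
  have hg := hT.isEnvelopable_conj
  have h0 := hM.1
  have h1 : 0 ≤ 1 - f M := by linarith [hM.2]
  have hphi : ∀ p, phi T f M p = (1 - f M) * deriv (convexEnvelope (conj T)) p + f M := fun p => by
    simp only [phi, delta']; ring
  refine
    { zero := by simp [nudged, hT.zero]
      one := by simp [nudged, hT.one]
      mono := fun x hx y hy hxy => ?_
      env_zero := by simp [hg.convexEnvelope_zero]
      env_one := by simp [hg.convexEnvelope_one]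
      continuousOn := ?_
      hasDerivAt := fun p hp => ?_
      monotoneOn := fun x hx y hy hxy => ?_
      nonneg := fun p hp => ?_
      le := fun q hq => ?_
      flat := fun q hq hlt => ?_ }
  · simp only [nudged]
    have := hT.strictMono.monotoneOn hx hy hxy
    gcongr
  · exact (continuousOn_const.mul hg.continuousOn_convexEnvelope).add (by fun_prop)
  · rw [hphi]
    have := ((hg.differentiableAt_convexEnvelope hp).hasDerivAt.const_mul (1 - f M)).add
      ((hasDerivAt_id p).const_mul (f M))
    rw [mul_one] at this
    exact this
  · rw [hphi, hphi]
    have := hg.monotoneOn_deriv hx hy hxy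
    gcongr
  · rw [hphi]
    have := hg.deriv_nonneg hp
    positivity
  · have := mul_le_mul_of_nonneg_left (hg.convexEnvelope_le hq) h1
    simp only [conj, nudged] at this ⊢
    linarith
  · have hlt' : convexEnvelope (conj T) q < conj T q := by
      refine lt_of_mul_lt_mul_left ?_ h1
      simp only [conj, nudged] at hlt ⊢
      linarith
    filter_upwards [hg.eventually_deriv_eq hq hlt'] with r hr
    rw [hphi, hphi, hr]

end DualDistortion

/-! ### Layer-cake formulas -/

section Layers

/-- Asymmetric layer-cake integral of a bounded random variable, reduced to a bounded interval. -/
lemma integral_layers_eq {G : ℝ → ℝ} (hG : Antitone G) {K : ℝ} (hK : 0 ≤ K)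
    (h1 : ∀ t ≤ -K, G t = 1) (h0 : ∀ t, K < t → G t = 0) :
    (∫ t in Ioi (0 : ℝ), G t) + ∫ t in Iic (0 : ℝ), (G t - 1) = (∫ t in (-K)..K, G t) - K := by
  have e1 : ∫ t in Ioi (0 : ℝ), G t = ∫ t in (0)..K, G t := by
    rw [intervalIntegral.integral_of_le hK]
    refine setIntegral_eq_of_subset_of_forall_sdiff_eq_zero measurableSet_Ioi Ioc_subset_Ioi_self
      fun t ht => h0 t ?_
    exact lt_of_not_ge fun h => ht.2 ⟨ht.1, h⟩
  have e2 : ∫ t in Iic (0 : ℝ), (G t - 1) = ∫ t in (-K)..0, (G t - 1) := by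
    rw [intervalIntegral.integral_of_le (by linarith)]
    refine setIntegral_eq_of_subset_of_forall_sdiff_eq_zero measurableSet_Iic Ioc_subset_Iic_self
      fun t ht => sub_eq_zero.2 (h1 t ?_)
    exact le_of_not_gt fun h => ht.2 ⟨h, ht.1⟩
  have hi : ∀ a b, IntervalIntegrable G volume a b := fun a b => hG.intervalIntegrable
  rw [e1, e2, intervalIntegral.integral_sub (hi _ _) (by simp),
    ← intervalIntegral.integral_add_adjacent_intervals (hi (-K) 0) (hi 0 K)]
  simp
  ring

variable {Ω : Type*} [MeasurableSpace Ω] {P : Measure Ω}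

/-- Layer-cake formula for the expectation of a bounded random variable under a probability
density. -/
lemma integral_mul_eq_layers {Z ψ : Ω → ℝ} (hZ : AEMeasurable Z P) {K : ℝ} (hK : 0 ≤ K)
    (hb : ∀ᵐ ω ∂P, |Z ω| ≤ K) (hψ : Integrable ψ P) (hψ0 : 0 ≤ᵐ[P] ψ) (hψ1 : ∫ ω, ψ ω ∂P = 1)
    [SFinite P] :
    ∫ ω, ψ ω * Z ω ∂P = (∫ t in (-K)..K, ∫ ω in {ω | t ≤ Z ω}, ψ ω ∂P) - K := by
  -- The weight is absorbed into a probability measure `Q`; the ordinary layer-cake formula is then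
  -- applied to `Z + K`, which is nonnegative almost surely.
  set Q := P.withDensity fun ω => ENNReal.ofReal (ψ ω) with hQ
  have hm : AEMeasurable (fun ω => ENNReal.ofReal (ψ ω)) P := hψ.1.aemeasurable.ennreal_ofReal
  have hQreal : ∀ s, Q.real s = ∫ ω in s, ψ ω ∂P := by
    intro s
    rw [integral_eq_lintegral_of_nonneg_ae (ae_restrict_of_ae hψ0) hψ.1.restrict, Measure.real,
      withDensity_apply']
  have hfin : IsFiniteMeasure Q := isFiniteMeasure_withDensity_ofReal hψ.2
  have hQ1 : Q.real univ = 1 := by rw [hQreal, setIntegral_univ, hψ1]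
  have hac : Q ≪ P := withDensity_absolutelyContinuous _ _
  have hbQ : ∀ᵐ ω ∂Q, |Z ω| ≤ K := hac.ae_le hb
  have hZQ : Integrable Z Q :=
    Integrable.of_bound (hZ.mono_ac hac).aestronglyMeasurable K hbQ
  have e1 : ∫ ω, Z ω ∂Q = ∫ ω, ψ ω * Z ω ∂P := by
    rw [integral_withDensity_eq_integral_toReal_smul₀ hm (by simp)]
    refine integral_congr_ae ?_
    filter_upwards [hψ0] with ω hω
    rw [ENNReal.toReal_ofReal hω, smul_eq_mul]
  have e2 : ∫ ω, (Z ω + K) ∂Q = ∫ t in Ioc 0 (2 * K), Q.real {ω | t ≤ Z ω + K} := by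
    refine Integrable.integral_eq_integral_Ioc_meas_le (hZQ.add (integrable_const K)) ?_ ?_
    · filter_upwards [hbQ] with ω hω
      have := (abs_le.1 hω).1
      simp only [Pi.zero_apply]
      linarith
    · filter_upwards [hbQ] with ω hω
      linarith [(abs_le.1 hω).2]
  rw [integral_add hZQ (integrable_const K), integral_const, hQ1, one_smul,
    ← intervalIntegral.integral_of_le (by linarith)] at e2
  have e3 : ∫ t in (0)..(2 * K), Q.real {ω | t ≤ Z ω + K} =
      ∫ t in (-K)..K, ∫ ω in {ω | t ≤ Z ω}, ψ ω ∂P := by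
    have := intervalIntegral.integral_comp_sub_right (a := 0) (b := 2 * K)
      (fun t => Q.real {ω | t ≤ Z ω}) K
    rw [zero_sub, show 2 * K - K = K by ring] at this
    simp only [← hQreal]
    rw [← this]
    simp only [sub_le_iff_le_add]
  rw [← e1, ← e3]
  linarith

lemma exists_bound_of_memLp_top {X : Ω → ℝ} (hX : MemLp X ⊤ P) :
    ∃ B, 0 < B ∧ ∀ᵐ ω ∂P, |X ω| ≤ B := by
  have h : eLpNormEssSup X P < ⊤ := by simpa using hX.2
  refine ⟨(eLpNormEssSup X P).toReal + 1, by positivity, ?_⟩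
  filter_upwards [ae_le_eLpNormEssSup (f := X) (μ := P)] with ω hω
  have : ‖X ω‖ ≤ (eLpNormEssSup X P).toReal := by
    rw [← toReal_enorm]
    exact ENNReal.toReal_mono h.ne hω
  rw [Real.norm_eq_abs] at this
  linarith

end Layers

/-! ### Rank-dependent utility against weighted expectation -/

section DistortedExpectation

variable {Ω : Type*} [MeasurableSpace Ω] {P : Measure Ω} {T Δ φ : ℝ → ℝ} {U : Ω → ℝ}

lemma IsDualDistortion.aemeasurable (hD : IsDualDistortion T Δ φ) :
    AEMeasurable φ (volume.restrict (Ioo 0 1)) :=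
  aemeasurable_restrict_of_monotoneOn measurableSet_Ioo hD.monotoneOn

/-- `φ` may be unbounded near `1`; integrability comes from its being the nonnegative derivative of
a function continuous up to the endpoints. -/
lemma IsDualDistortion.integrableOn (hD : IsDualDistortion T Δ φ) :
    IntegrableOn φ (Ioc 0 1) :=
  intervalIntegral.integrableOn_deriv_of_nonneg hD.continuousOn hD.hasDerivAt hD.nonneg

lemma IsDualDistortion.integral_Ioc (hD : IsDualDistortion T Δ φ) {q : ℝ}
    (hq : q ∈ Icc (0 : ℝ) 1) : ∫ p in Ioc q 1, φ p = 1 - Δ q := by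
  rw [← intervalIntegral.integral_of_le hq.2, show 1 - Δ q = Δ 1 - Δ q by rw [hD.env_one]]
  refine intervalIntegral.integral_eq_sub_of_hasDerivAt_of_le hq.2
    (hD.continuousOn.mono (Icc_subset_Icc_left hq.1))
    (fun x hx => hD.hasDerivAt x ⟨hq.1.trans_lt hx.1, hx.2⟩) ?_
  rw [intervalIntegrable_iff_integrableOn_Ioc_of_le hq.2]
  exact hD.integrableOn.mono_set (Ioc_subset_Ioc_left hq.1)

variable (hD : IsDualDistortion T Δ φ) (hU : Measurable U)
  (hmap : P.map U = volume.restrict (Ioo 0 1))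

include hD hU hmap

lemma IsDualDistortion.integrable_comp : Integrable (fun ω => φ (U ω)) P := by
  have h : Integrable φ (P.map U) := by
    rw [hmap]
    exact hD.integrableOn.mono_set Ioo_subset_Ioc_self
  exact h.comp_measurable hU

lemma IsDualDistortion.ae_nonneg : 0 ≤ᵐ[P] fun ω => φ (U ω) := by
  filter_upwards [ae_mem_of_uniform hU hmap] with ω hω using hD.nonneg _ hω

lemma IsDualDistortion.setIntegral_comp {q : ℝ} (hq : q ∈ Icc (0 : ℝ) 1) :
    ∫ ω in {ω | q ≤ U ω}, φ (U ω) ∂P = 1 - Δ q := by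
  have h1 := setIntegral_map (μ := P) (g := U) (f := φ) (s := Ici q) measurableSet_Ici
    (by rw [hmap]; exact hD.aemeasurable.aestronglyMeasurable) hU.aemeasurable
  have h2 : (Ici q ∩ Ioo 0 1 : Set ℝ) =ᵐ[volume] Ioc q 1 := by
    filter_upwards [Measure.ae_ne volume q, Measure.ae_ne volume (1 : ℝ)] with x hxq hx1
    refine propext ⟨fun h => ⟨lt_of_le_of_ne h.1 hxq.symm, h.2.2.le⟩, fun h => ?_⟩
    exact ⟨h.1.le, hq.1.trans_lt h.1, lt_of_le_of_ne h.2 hx1⟩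
  rw [hmap, Measure.restrict_restrict measurableSet_Ici, setIntegral_congr_set h2,
    hD.integral_Ioc hq] at h1
  exact h1.symm

lemma IsDualDistortion.integral_comp : ∫ ω, φ (U ω) ∂P = 1 := by
  have h := hD.setIntegral_comp hU hmap (q := 0) (by simp)
  rw [hD.env_zero, sub_zero] at h
  rw [← h]
  refine (setIntegral_eq_integral_of_ae_compl_eq_zero ?_).symm
  filter_upwards [ae_mem_of_uniform hU hmap] with ω hω h
  exact absurd hω.1.le h

/-- Sortedness replaces the upper level set by `{q ≤ U}`, so both layer integrands become functions
of the same number `q`. -/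
lemma IsDualDistortion.upper_level [IsProbabilityMeasure P] {Z : Ω → ℝ} (hZ : AEMeasurable Z P)
    (hs : SortedBy P Z U) (t : ℝ) :
    P.real {ω | t ≤ Z ω} = 1 - P.real {ω | Z ω ∈ Iio t} ∧
      ∫ ω in {ω | t ≤ Z ω}, φ (U ω) ∂P = 1 - Δ (P.real {ω | Z ω ∈ Iio t}) := by
  have hc : {ω | t ≤ Z ω} = {ω | Z ω ∈ Iio t}ᶜ := by ext; simp
  have hm : NullMeasurableSet {ω | Z ω ∈ Iio t} P := hZ.nullMeasurableSet_preimage measurableSet_Iio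
  constructor
  · rw [hc, Measure.real, Measure.real, prob_compl_eq_one_sub₀ hm,
      ENNReal.toReal_sub_of_le prob_le_one (by simp), ENNReal.toReal_one]
  · set q := P.real {ω | Z ω ∈ Iio t} with hq
    have h : {ω | t ≤ Z ω} =ᵐ[P] {ω | q ≤ U ω} := by
      have := (hs (Iio t) (isLowerSet_Iio t)).compl
      rw [← hc, ← hq] at this
      refine this.trans (Eq.eventuallyEq (Set.ext fun ω => by simp))
    rw [setIntegral_congr_set h]
    exact hD.setIntegral_comp hU hmap ⟨measureReal_nonneg, measureReal_le_one⟩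

/-- The rank-dependent utility is bounded by the expectation of utility weighted with the
derivative of a convex minorant, with equality if no level set is in a flat part. -/
lemma IsDualDistortion.rdu_le [IsProbabilityMeasure P] {u : ℝ → ℝ} {X : Ω → ℝ} (hu : Monotone u)
    (hX : AEMeasurable X P) {B : ℝ} (hb : ∀ᵐ ω ∂P, |X ω| ≤ B) (hs : SortedBy P X U) :
    rdu P u T X ≤ ∫ ω, φ (U ω) * u (X ω) ∂P ∧
      ((∀ S : Set ℝ, IsLowerSet S → T (1 - P.real {ω | X ω ∈ S}) = 1 - Δ (P.real {ω | X ω ∈ S})) →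
        rdu P u T X = ∫ ω, φ (U ω) * u (X ω) ∂P) := by
  set Z : Ω → ℝ := fun ω => u (X ω) with hZdef
  have hZ : AEMeasurable Z P := hu.measurable.comp_aemeasurable hX
  have hsZ : SortedBy P Z U := hs.comp hu
  set K : ℝ := |u (-B)| + |u B| with hKdef
  have hK : 0 ≤ K := by positivity
  have hbZ : ∀ᵐ ω ∂P, |Z ω| ≤ K := by
    filter_upwards [hb] with ω hω
    have h1 := hu (abs_le.1 hω).1
    have h2 := hu (abs_le.1 hω).2
    rw [abs_le]
    constructor
    · linarith [neg_abs_le (u (-B)), abs_nonneg (u B)]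
    · linarith [le_abs_self (u B), abs_nonneg (u (-B))]
  set G : ℝ → ℝ := fun t => T (P.real {ω | t ≤ Z ω}) with hG
  have hmem : ∀ s : Set Ω, P.real s ∈ Icc (0 : ℝ) 1 := fun s =>
    ⟨measureReal_nonneg, measureReal_le_one⟩
  have hGanti : Antitone G := fun s t hst =>
    hD.mono (hmem _) (hmem _) (measureReal_mono fun ω hω => hst.trans hω)
  have hG1 : ∀ t ≤ -K, G t = 1 := by
    intro t ht
    have : P.real {ω | t ≤ Z ω} = P.real univ := by
      refine measureReal_congr ?_
      filter_upwards [hbZ] with ω hω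
      exact propext ⟨fun _ => trivial, fun _ => ht.trans (abs_le.1 hω).1⟩
    simp only [hG]
    rw [this, probReal_univ, hD.one]
  have hG0 : ∀ t, K < t → G t = 0 := by
    intro t ht
    have : P.real {ω | t ≤ Z ω} = P.real (∅ : Set Ω) := by
      refine measureReal_congr ?_
      filter_upwards [hbZ] with ω hω
      refine propext ⟨fun h => ?_, fun h => h.elim⟩
      exact absurd ((ht.trans_le h).trans_le (abs_le.1 hω).2) (lt_irrefl _)
    simp only [hG]
    rw [this, measureReal_empty, hD.zero]
  have e1 : rdu P u T X = (∫ t in (-K)..K, G t) - K := by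
    rw [← integral_layers_eq hGanti hK hG1 hG0]
    simp only [rdu, choquet, hG, probReal_univ, hD.one]
    rfl
  have hint := hD.integrable_comp hU hmap
  have hnn := hD.ae_nonneg hU hmap
  have e2 := integral_mul_eq_layers hZ hK hbZ hint hnn (hD.integral_comp hU hmap)
  have hHanti : Antitone fun t => ∫ ω in {ω | t ≤ Z ω}, φ (U ω) ∂P := fun s t hst =>
    setIntegral_mono_set hint.integrableOn (ae_restrict_of_ae hnn)
      (Eventually.of_forall fun ω hω => hst.trans hω)
  rw [e1, e2]
  constructor
  -- Layer by layer, the claim is now `T (1 - q) ≤ 1 - Δ q`.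
  · refine sub_le_sub_right (intervalIntegral.integral_mono_on (by linarith)
      hGanti.intervalIntegrable hHanti.intervalIntegrable fun t _ => ?_) _
    obtain ⟨h1, h2⟩ := hD.upper_level hU hmap hZ hsZ t
    simp only [hG]
    rw [h2, h1]
    exact hD.le _ (hmem _)
  · intro hT
    congr 1
    refine intervalIntegral.integral_congr fun t _ => ?_
    obtain ⟨h1, h2⟩ := hD.upper_level hU hmap hZ hsZ t
    simp only [hG]
    rw [h2, h1]
    exact hT (u ⁻¹' Iio t) fun a b hba ha => (hu hba).trans_lt ha

omit hD in
/-- For a nondecreasing function `h` on `(0,1)`, the transform `h(U)` is sorted by `U`, and the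
probability of `{h(U) ∈ S}`, for a lower set `S`, separates the points of `h ⁻¹(S)`. -/
lemma sortedBy_comp_uniform [IsProbabilityMeasure P] {h : ℝ → ℝ} (hh : MonotoneOn h (Ioo 0 1))
    {S : Set ℝ} (hS : IsLowerSet S) {p : ℝ} (hp : p ∈ Ioo (0 : ℝ) 1) :
    (h p ∈ S → p ≤ P.real {ω | h (U ω) ∈ S}) ∧ (h p ∉ S → P.real {ω | h (U ω) ∈ S} ≤ p) := by
  have hlt := measure_lt_of_uniform hU hmap hp.1.le hp.2.le
  have hI := ae_mem_of_uniform hU hmap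
  constructor
  · intro hpS
    calc p = P.real {ω | U ω < p} := hlt.symm
      _ ≤ _ := by
        refine ENNReal.toReal_mono (measure_ne_top _ _) (measure_mono_ae ?_)
        filter_upwards [hI] with ω hω hlt
        exact hS (hh hω hp (le_of_lt hlt)) hpS
  · intro hpS
    refine le_trans ?_ hlt.le
    refine ENNReal.toReal_mono (measure_ne_top _ _) (measure_mono_ae ?_)
    filter_upwards [hI] with ω hω hmem
    refine lt_of_not_ge fun hle => hpS (hS (hh hp hω hle) hmem)

omit hD in
lemma SortedBy.of_monotoneOn [IsProbabilityMeasure P] {h : ℝ → ℝ}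
    (hh : MonotoneOn h (Ioo 0 1)) : SortedBy P (fun ω => h (U ω)) U := by
  intro S hS
  filter_upwards [ae_mem_of_uniform hU hmap,
    ae_ne_of_uniform hU hmap (P.real {ω | h (U ω) ∈ S})] with ω hω hne
  obtain ⟨h1, h2⟩ := sortedBy_comp_uniform hU hmap hh hS hω
  refine propext ⟨fun hm => lt_of_le_of_ne (h1 hm) hne, fun hm => ?_⟩
  by_contra hn
  exact absurd (h2 hn) (not_le.2 hm)

/-- A monotone transform of `φ(U)` jumps only at contact points. -/
lemma IsDualDistortion.contact [IsProbabilityMeasure P] {a : ℝ → ℝ}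
    (ha : MonotoneOn (fun p => a (φ p)) (Ioo 0 1)) {S : Set ℝ} (hS : IsLowerSet S) :
    T (1 - P.real {ω | a (φ (U ω)) ∈ S}) = 1 - Δ (P.real {ω | a (φ (U ω)) ∈ S}) := by
  set q := P.real {ω | a (φ (U ω)) ∈ S} with hq
  have hq0 : 0 ≤ q := measureReal_nonneg
  have hq1 : q ≤ 1 := measureReal_le_one
  rcases eq_or_lt_of_le hq0 with h0 | h0
  · rw [← h0, sub_zero, hD.one, hD.env_zero, sub_zero]
  rcases eq_or_lt_of_le hq1 with h1 | h1
  · rw [h1, sub_self, hD.zero, hD.env_one, sub_self]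
  by_contra hne
  have hlt := lt_of_le_of_ne (hD.le q ⟨hq0, hq1⟩) hne
  have hev : ∀ᶠ r in 𝓝 q, φ r = φ q ∧ r ∈ Ioo (0 : ℝ) 1 :=
    (hD.flat q ⟨h0, h1⟩ hlt).and (Ioo_mem_nhds h0 h1)
  obtain ⟨η, hη, hb⟩ := Metric.eventually_nhds_iff_ball.1 hev
  have hl := hb (q - η / 2) (by
    rw [Metric.mem_ball, Real.dist_eq, abs_lt]; constructor <;> linarith)
  have hr := hb (q + η / 2) (by
    rw [Metric.mem_ball, Real.dist_eq, abs_lt]; constructor <;> linarith)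
  have hL := sortedBy_comp_uniform hU hmap ha hS hl.2
  have hR := sortedBy_comp_uniform hU hmap ha hS hr.2
  rw [hl.1, ← hq] at hL
  rw [hr.1, ← hq] at hR
  -- `φ` takes the value `φ q` at `q ± η / 2`, so both points are on the same side of `S`, whereas
  -- `q` must separate members of the preimage of `S` from non-members.
  by_cases hm : a (φ q) ∈ S
  · linarith [hR.1 hm]
  · linarith [hL.2 hm]

end DistortedExpectation

/-! ### Pointwise sharing of a constant amount -/

noncomputable section Sharing

variable {u₁ u₂ : ℝ → ℝ} {lam c B d x : ℝ}

/-- The weighted welfare `d u₁(x) + lam u₂(c - x)` of sharing `c` as `(x, c - x)`. -/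
def obj (u₁ u₂ : ℝ → ℝ) (lam c d x : ℝ) : ℝ := d * u₁ x + lam * u₂ (c - x)

/-- A best share within `[-B, B]`. -/
def best (u₁ u₂ : ℝ → ℝ) (lam c B d : ℝ) : ℝ :=
  Classical.epsilon fun x => x ∈ Icc (-B) B ∧ IsMaxOn (obj u₁ u₂ lam c d) (Icc (-B) B) x

lemma hasDerivAt_obj (hu₁ : IsUtility u₁) (hu₂ : IsUtility u₂) (lam c d x : ℝ) :
    HasDerivAt (obj u₁ u₂ lam c d) (d * deriv u₁ x - lam * deriv u₂ (c - x)) x := by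
  have h1 := (hu₁.differentiable x).hasDerivAt.const_mul d
  have h2 : HasDerivAt (fun x => u₂ (c - x)) (deriv u₂ (c - x) * -1) x :=
    (hu₂.differentiable (c - x)).hasDerivAt.comp x ((hasDerivAt_id x).const_sub c)
  refine (h1.add (h2.const_mul lam)).congr_deriv ?_
  ring

/-- Strictness is drawn from the second agent, since the weight `d` of the first is allowed to
vanish. -/
lemma strictConcaveOn_obj (hu₁ : IsUtility u₁) (hu₂ : IsUtility u₂) (hlam : 0 < lam) (hd : 0 ≤ d) :
    StrictConcaveOn ℝ univ (obj u₁ u₂ lam c d) := by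
  refine ⟨convex_univ, fun x _ y _ hxy a b ha hb hab => ?_⟩
  have h1 := hu₁.strictConcave.concaveOn.2 (mem_univ x) (mem_univ y) ha.le hb.le hab
  have h2 := hu₂.strictConcave.2 (mem_univ (c - x)) (mem_univ (c - y))
    (fun h => hxy (by linarith)) ha hb hab
  have e : a • (c - x) + b • (c - y) = c - (a • x + b • y) := by
    obtain rfl : b = 1 - a := by linarith
    simp only [smul_eq_mul]
    ring
  rw [e] at h2
  have h3 := mul_le_mul_of_nonneg_left h1 hd
  have h4 := mul_lt_mul_of_pos_left h2 hlam
  simp only [obj, smul_eq_mul] at h3 h4 ⊢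
  linarith

lemma best_spec (hu₁ : IsUtility u₁) (hu₂ : IsUtility u₂) (hB : 0 < B) (lam c d : ℝ) :
    best u₁ u₂ lam c B d ∈ Icc (-B) B ∧
      IsMaxOn (obj u₁ u₂ lam c d) (Icc (-B) B) (best u₁ u₂ lam c B d) := by
  obtain ⟨x, hx, hmax⟩ := isCompact_Icc.exists_isMaxOn
    (nonempty_Icc.2 (show -B ≤ B by linarith))
    (f := obj u₁ u₂ lam c d) fun x _ =>
      (hasDerivAt_obj hu₁ hu₂ lam c d x).continuousAt.continuousWithinAt
  exact Classical.epsilon_spec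
    (p := fun x => x ∈ Icc (-B) B ∧ IsMaxOn (obj u₁ u₂ lam c d) (Icc (-B) B) x) ⟨x, hx, hmax⟩

lemma eq_best (hu₁ : IsUtility u₁) (hu₂ : IsUtility u₂) (hlam : 0 < lam) (hB : 0 < B) (hd : 0 ≤ d)
    (hx : x ∈ Icc (-B) B) (hmax : obj u₁ u₂ lam c d (best u₁ u₂ lam c B d) ≤ obj u₁ u₂ lam c d x) :
    x = best u₁ u₂ lam c B d := by
  obtain ⟨h1, h2⟩ := best_spec hu₁ hu₂ hB lam c d
  exact ((strictConcaveOn_obj hu₁ hu₂ hlam hd).subset (subset_univ _)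
    (convex_Icc _ _)).eq_of_isMaxOn
    (fun y hy => (h2 hy).trans hmax) h2 hx h1

/-- Exchange argument: adding the two optimality inequalities gives `(d' - d) (u₁(x') - u₁(x)) ≥ 0`,
where `x` and `x'` are the best shares for `d` and `d'`. Thus a larger weight cannot come with a
smaller share. -/
lemma monotoneOn_best (hu₁ : IsUtility u₁) (hu₂ : IsUtility u₂) (hB : 0 < B) :
    MonotoneOn (best u₁ u₂ lam c B) (Ici 0) := by
  intro d hd d' hd' hdd
  by_contra hlt
  have hlt := not_le.1 hlt
  obtain ⟨h1, h2⟩ := best_spec hu₁ hu₂ hB lam c d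
  obtain ⟨h1', h2'⟩ := best_spec hu₁ hu₂ hB lam c d'
  have e1 : obj u₁ u₂ lam c d (best u₁ u₂ lam c B d') ≤ _ := h2 h1'
  have e2 : obj u₁ u₂ lam c d' (best u₁ u₂ lam c B d) ≤ _ := h2' h1
  have hu := hu₁.strictMono hlt
  have hle : d' ≤ d := by
    simp only [obj] at e1 e2
    by_contra h
    nlinarith [mul_pos (sub_pos.2 (not_le.1 h)) (sub_pos.2 hu)]
  rw [le_antisymm hdd hle] at hlt
  exact lt_irrefl _ hlt

/-- The first-order condition characterizes global maximizers. -/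
lemma isMaxOn_obj_of_eq (hu₁ : IsUtility u₁) (hu₂ : IsUtility u₂) (hlam : 0 < lam) (hd : 0 ≤ d)
    (hx : d = lam * (deriv u₂ (c - x) / deriv u₁ x)) (y : ℝ) :
    obj u₁ u₂ lam c d y ≤ obj u₁ u₂ lam c d x := by
  have h0 : d * deriv u₁ x - lam * deriv u₂ (c - x) = 0 := by
    have := (hu₁.deriv_pos x).ne'
    rw [hx]
    field_simp
    ring
  have hder := (hasDerivAt_obj hu₁ hu₂ lam c d x).neg
  rw [h0, neg_zero] at hder
  have hconv := (strictConcaveOn_obj (c := c) hu₁ hu₂ hlam hd).concaveOn.neg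
  have hmin := hconv.isMinOn_of_rightDeriv_eq_zero
    (x := x) (by simp) (hder.hasDerivWithinAt.derivWithin (uniqueDiffWithinAt_Ioi x))
  have : -obj u₁ u₂ lam c d x ≤ -obj u₁ u₂ lam c d y := hmin (mem_univ y)
  linarith

lemma eq_of_interior_max (hu₁ : IsUtility u₁) (hu₂ : IsUtility u₂) (hB : 0 < B)
    (hx : best u₁ u₂ lam c B d ∈ Ioo (-B) B) :
    lam * (deriv u₂ (c - best u₁ u₂ lam c B d) / deriv u₁ (best u₁ u₂ lam c B d)) = d := by
  set x := best u₁ u₂ lam c B d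
  have hloc := (best_spec hu₁ hu₂ hB lam c d).2.isLocalMax (Icc_mem_nhds hx.1 hx.2)
  have h0 := hloc.hasDerivAt_eq_zero (hasDerivAt_obj hu₁ hu₂ lam c d x)
  have := (hu₁.deriv_pos x).ne'
  field_simp
  linarith

end Sharing

/-! ### Characterization of optimal allocations -/

section Optimality

variable {Ω : Type*} [MeasurableSpace Ω] {P : Measure Ω}
  {T Δ φ : ℝ → ℝ} {U X Y₁ Y₂ : Ω → ℝ} {u u₁ u₂ : ℝ → ℝ} {lam c B : ℝ}

lemma IsUtility.continuous (hu : IsUtility u) : Continuous u := hu.differentiable.continuous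

lemma IsUtility.exists_bound (hu : IsUtility u) (hb : ∀ᵐ ω ∂P, |X ω| ≤ B) :
    ∃ K, ∀ᵐ ω ∂P, ‖u (X ω)‖ ≤ K := by
  obtain ⟨K, hK⟩ := isCompact_Icc.exists_bound_of_continuousOn
    (hu.continuous.continuousOn (s := Icc (-B) B))
  refine ⟨K, ?_⟩
  filter_upwards [hb] with ω hω using hK _ (abs_le.1 hω)

lemma integrable_eu [IsProbabilityMeasure P]
    (hu : IsUtility u) (hX : AEMeasurable X P) (hb : ∀ᵐ ω ∂P, |X ω| ≤ B) (c : ℝ) :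
    Integrable (fun ω => u (c - X ω)) P := by
  have hb' : ∀ᵐ ω ∂P, |c - X ω| ≤ |c| + B := by
    filter_upwards [hb] with ω hω
    exact (abs_sub _ _).trans (by linarith)
  obtain ⟨K, hK⟩ := hu.exists_bound (X := fun ω => c - X ω) hb'
  exact Integrable.of_bound
    (hu.continuous.comp_aestronglyMeasurable
      (aestronglyMeasurable_const.sub hX.aestronglyMeasurable)) K hK

lemma IsDualDistortion.integrable_mul (hD : IsDualDistortion T Δ φ) (hU : Measurable U)
    (hmap : P.map U = volume.restrict (Ioo 0 1)) (hu : IsUtility u) (hX : AEMeasurable X P)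
    (hb : ∀ᵐ ω ∂P, |X ω| ≤ B) : Integrable (fun ω => φ (U ω) * u (X ω)) P := by
  obtain ⟨K, hK⟩ := hu.exists_bound hb
  exact (hD.integrable_comp hU hmap).mul_bdd
    (hu.continuous.comp_aestronglyMeasurable hX.aestronglyMeasurable) hK

lemma IsDualDistortion.integral_obj [IsProbabilityMeasure P]
    (hD : IsDualDistortion T Δ φ) (hU : Measurable U)
    (hmap : P.map U = volume.restrict (Ioo 0 1)) (hu₁ : IsUtility u₁) (hu₂ : IsUtility u₂)
    (hX : AEMeasurable X P) (hb : ∀ᵐ ω ∂P, |X ω| ≤ B) :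
    Integrable (fun ω => obj u₁ u₂ lam c (φ (U ω)) (X ω)) P ∧
    ∫ ω, obj u₁ u₂ lam c (φ (U ω)) (X ω) ∂P =
      ∫ ω, φ (U ω) * u₁ (X ω) ∂P + lam * ∫ ω, u₂ (c - X ω) ∂P := by
  have h1 := hD.integrable_mul hU hmap hu₁ hX hb
  have h2 := (integrable_eu hu₂ hX hb c).const_mul lam
  refine ⟨h1.add h2, ?_⟩
  simp only [obj]
  rw [integral_add h1 h2, integral_const_mul]

lemma eu_eq_of_feasible (h : Feasible P c Y₁ Y₂) : eu P u Y₂ = ∫ ω, u (c - Y₁ ω) ∂P := by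
  refine integral_congr_ae ?_
  filter_upwards [h.2.2] with ω hω
  rw [← hω, add_sub_cancel_left]

lemma IsDualDistortion.monotoneOn_best (hD : IsDualDistortion T Δ φ) (hu₁ : IsUtility u₁)
    (hu₂ : IsUtility u₂) (hB : 0 < B) :
    MonotoneOn (fun p => best u₁ u₂ lam c B (φ p)) (Ioo 0 1) := fun p hp q hq hpq =>
  Nudging.monotoneOn_best hu₁ hu₂ hB (hD.nonneg p hp) (hD.nonneg q hq)
    (hD.monotoneOn hp hq hpq)

lemma IsDualDistortion.aemeasurable_best (hD : IsDualDistortion T Δ φ) (hU : Measurable U)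
    (hmap : P.map U = volume.restrict (Ioo 0 1)) (hu₁ : IsUtility u₁)
    (hu₂ : IsUtility u₂) (hB : 0 < B) :
    AEMeasurable (fun ω => best u₁ u₂ lam c B (φ (U ω))) P := by
  have h := aemeasurable_restrict_of_monotoneOn (μ := volume) measurableSet_Ioo
    (hD.monotoneOn_best (lam := lam) (c := c) hu₁ hu₂ hB)
  rw [← hmap] at h
  exact h.comp_measurable hU

lemma abs_best_le (hu₁ : IsUtility u₁) (hu₂ : IsUtility u₂) (hB : 0 < B) (d : ℝ) :
    |best u₁ u₂ lam c B d| ≤ B :=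
  abs_le.2 (best_spec hu₁ hu₂ hB lam c d).1

/-- The optimal value over allocations bounded by `B` depends on the law of `U` only. -/
lemma IsDualDistortion.integral_obj_best (hD : IsDualDistortion T Δ φ) (hU : Measurable U)
    (hmap : P.map U = volume.restrict (Ioo 0 1)) (hu₁ : IsUtility u₁)
    (hu₂ : IsUtility u₂) (hB : 0 < B) :
    ∫ ω, obj u₁ u₂ lam c (φ (U ω)) (best u₁ u₂ lam c B (φ (U ω))) ∂P =
      ∫ p in Ioo 0 1, obj u₁ u₂ lam c (φ p) (best u₁ u₂ lam c B (φ p)) := by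
  rw [← hmap]
  refine (integral_map (f := fun p => obj u₁ u₂ lam c (φ p) (best u₁ u₂ lam c B (φ p)))
    hU.aemeasurable ?_).symm
  rw [hmap]
  have h1 := hD.aemeasurable
  have h2 := aemeasurable_restrict_of_monotoneOn (μ := volume) measurableSet_Ioo
    (hD.monotoneOn_best (lam := lam) (c := c) hu₁ hu₂ hB)
  exact ((h1.mul (hu₁.continuous.measurable.comp_aemeasurable h2)).add
    ((hu₂.continuous.measurable.comp_aemeasurable (h2.const_sub c)).const_mul
      lam)).aestronglyMeasurable

/-- Feasibility eliminates the second agent's share, and `rdu_le` replaces the Choquet integral by a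
linear functional of `u₁(Y₁)`, leaving a problem that separates over `ω`. -/
lemma IsDualDistortion.welfare_le_integral_obj [IsProbabilityMeasure P]
    (hD : IsDualDistortion T Δ φ) (hU : Measurable U)
    (hmap : P.map U = volume.restrict (Ioo 0 1)) (hu₁ : IsUtility u₁)
    (hu₂ : IsUtility u₂) (hY : Feasible P c Y₁ Y₂)
    (hb : ∀ᵐ ω ∂P, |Y₁ ω| ≤ B) (hs : SortedBy P Y₁ U) :
    rdu P u₁ T Y₁ + lam * eu P u₂ Y₂ ≤ ∫ ω, obj u₁ u₂ lam c (φ (U ω)) (Y₁ ω) ∂P := by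
  have hm := hY.1.1.aemeasurable
  rw [(hD.integral_obj hU hmap hu₁ hu₂ hm hb).2, eu_eq_of_feasible hY]
  exact add_le_add_left (hD.rdu_le hU hmap hu₁.mono hm hb hs).1 _

lemma IsDualDistortion.integral_obj_le [IsProbabilityMeasure P]
    (hD : IsDualDistortion T Δ φ) (hU : Measurable U)
    (hmap : P.map U = volume.restrict (Ioo 0 1)) (hu₁ : IsUtility u₁)
    (hu₂ : IsUtility u₂) (hB : 0 < B) (hX : AEMeasurable X P)
    (hb : ∀ᵐ ω ∂P, |X ω| ≤ B) :
    ∫ ω, obj u₁ u₂ lam c (φ (U ω)) (X ω) ∂P ≤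
      ∫ p in Ioo 0 1, obj u₁ u₂ lam c (φ p) (best u₁ u₂ lam c B (φ p)) := by
  rw [← hD.integral_obj_best hU hmap hu₁ hu₂ hB]
  refine integral_mono_ae (hD.integral_obj hU hmap hu₁ hu₂ hX hb).1
    (hD.integral_obj hU hmap hu₁ hu₂ (hD.aemeasurable_best hU hmap hu₁ hu₂ hB)
      (Eventually.of_forall fun ω => abs_best_le hu₁ hu₂ hB _)).1 ?_
  filter_upwards [hb] with ω hω
  exact (best_spec hu₁ hu₂ hB lam c (φ (U ω))).2 (abs_le.1 hω)

/-- Sharing according to the best share attains the bound. -/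
lemma IsDualDistortion.welfare_best [IsProbabilityMeasure P]
    (hD : IsDualDistortion T Δ φ) (hU : Measurable U)
    (hmap : P.map U = volume.restrict (Ioo 0 1)) (hu₁ : IsUtility u₁)
    (hu₂ : IsUtility u₂) (hB : 0 < B) (hY : Feasible P c Y₁ Y₂)
    (hbest : ∀ᵐ ω ∂P, Y₁ ω = best u₁ u₂ lam c B (φ (U ω))) :
    rdu P u₁ T Y₁ + lam * eu P u₂ Y₂ =
      ∫ p in Ioo 0 1, obj u₁ u₂ lam c (φ p) (best u₁ u₂ lam c B (φ p)) := by
  have hm := hY.1.1.aemeasurable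
  have hmono := hD.monotoneOn_best (lam := lam) (c := c) hu₁ hu₂ hB
  have hb : ∀ᵐ ω ∂P, |Y₁ ω| ≤ B := by
    filter_upwards [hbest] with ω hω
    rw [hω]
    exact abs_best_le hu₁ hu₂ hB _
  have hs : SortedBy P Y₁ U :=
    (SortedBy.of_monotoneOn hU hmap hmono).congr (EventuallyEq.symm hbest)
  have hcontact : ∀ S : Set ℝ, IsLowerSet S →
      T (1 - P.real {ω | Y₁ ω ∈ S}) = 1 - Δ (P.real {ω | Y₁ ω ∈ S}) := by
    intro S hS
    have e : P.real {ω | Y₁ ω ∈ S} = P.real {ω | best u₁ u₂ lam c B (φ (U ω)) ∈ S} := by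
      refine measureReal_congr ?_
      filter_upwards [hbest] with ω hω
      exact propext (show Y₁ ω ∈ S ↔ best u₁ u₂ lam c B (φ (U ω)) ∈ S by rw [hω])
    rw [e]
    exact hD.contact hU hmap hmono hS
  rw [(hD.rdu_le hU hmap hu₁.mono hm hb hs).2 hcontact, eu_eq_of_feasible hY,
    ← (hD.integral_obj hU hmap hu₁ hu₂ hm hb).2, ← hD.integral_obj_best hU hmap hu₁ hu₂ hB]
  refine integral_congr_ae ?_
  filter_upwards [hbest] with ω hω
  rw [hω]

/-- Optimal allocations are those that satisfy the first-order condition with the derivative of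
the convex minorant at a uniform random variable as weight of the first agent. -/
lemma IsDualDistortion.solves_iff [IsProbabilityMeasure P]
    (hP : IsNonatomic P) (hD : IsDualDistortion T Δ φ)
    (hu₁ : IsUtility u₁) (hu₂ : IsUtility u₂) (hlam : 0 < lam) {X₁ X₂ : Ω → ℝ}
    (h₁ : MemLp X₁ ⊤ P) (h₂ : MemLp X₂ ⊤ P) :
    Solves P u₁ u₂ T lam c X₁ X₂ ↔ ∃ U : Ω → ℝ, Measurable U ∧
      P.map U = volume.restrict (Ioo 0 1) ∧
      ∀ᵐ ω ∂P, lam * (deriv u₂ (c - X₁ ω) / deriv u₁ (X₁ ω)) = φ (U ω) ∧ X₂ ω = c - X₁ ω := by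
  obtain ⟨B, hB, hb⟩ := exists_bound_of_memLp_top h₁
  have hm := h₁.1.aemeasurable
  constructor
  · rintro ⟨hfeas, hopt⟩
    obtain ⟨U, hU, hmap, hs⟩ := hP.exists_sortedBy hm
    refine ⟨U, hU, hmap, ?_⟩
    -- Enlarging the bound by `1` keeps `X₁` in the interior of the interval, where the first-order
    -- condition holds at a maximizer.
    have hB1 : 0 < B + 1 := by linarith
    have hb1 : ∀ᵐ ω ∂P, |X₁ ω| ≤ B + 1 := by
      filter_upwards [hb] with ω hω
      linarith
    set Y : Ω → ℝ := fun ω => best u₁ u₂ lam c (B + 1) (φ (U ω)) with hY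
    have hYm : AEMeasurable Y P := hD.aemeasurable_best hU hmap hu₁ hu₂ hB1
    have hYb : ∀ᵐ ω ∂P, |Y ω| ≤ B + 1 :=
      Eventually.of_forall fun ω => abs_best_le hu₁ hu₂ hB1 _
    have hYL : MemLp Y ⊤ P := memLp_top_of_bound hYm.aestronglyMeasurable _ hYb
    have hYf : Feasible P c Y (fun ω => c - Y ω) :=
      ⟨hYL, (memLp_const c).sub hYL, Eventually.of_forall fun ω => by ring⟩
    have e1 := hopt _ _ hYf
    rw [hD.welfare_best hU hmap hu₁ hu₂ hB1 hYf (Eventually.of_forall fun _ => rfl),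
      ← hD.integral_obj_best hU hmap hu₁ hu₂ hB1] at e1
    have e2 := e1.trans (hD.welfare_le_integral_obj hU hmap hu₁ hu₂ hfeas hb1 hs)
    have i1 := (hD.integral_obj (lam := lam) (c := c) hU hmap hu₁ hu₂ hm hb1).1
    have i2 := (hD.integral_obj (lam := lam) (c := c) hU hmap hu₁ hu₂ hYm hYb).1
    have hle : (fun ω => obj u₁ u₂ lam c (φ (U ω)) (X₁ ω)) ≤ᵐ[P]
        fun ω => obj u₁ u₂ lam c (φ (U ω)) (Y ω) := by
      filter_upwards [hb1] with ω hω
      exact (best_spec hu₁ hu₂ hB1 lam c (φ (U ω))).2 (abs_le.1 hω)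
    -- Optimality closes the chain: objective at `Y` ≤ welfare of `X₁` ≤ objective at `X₁` ≤
    -- objective at `Y`, in expectation. The last inequality is pointwise, so it is an equality
    -- almost surely.
    have hae := (integral_eq_iff_of_ae_le i1 i2 hle).1 (le_antisymm (integral_mono_ae i1 i2 hle) e2)
    filter_upwards [hae, hb, hfeas.2.2, hD.ae_nonneg hU hmap] with ω h1 h2 h3 h4
    have h2' := abs_le.1 h2
    have hX : X₁ ω = best u₁ u₂ lam c (B + 1) (φ (U ω)) :=
      eq_best hu₁ hu₂ hlam hB1 h4 ⟨by linarith, by linarith⟩ h1.symm.le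
    refine ⟨?_, by linarith⟩
    have := eq_of_interior_max (lam := lam) (c := c) (d := φ (U ω)) hu₁ hu₂ hB1
      (by rw [← hX]; constructor <;> linarith)
    rwa [← hX] at this
  · rintro ⟨U, hU, hmap, hUX⟩
    have hfeas : Feasible P c X₁ X₂ := by
      refine ⟨h₁, h₂, ?_⟩
      filter_upwards [hUX] with ω hω
      rw [hω.2]
      ring
    refine ⟨hfeas, fun Y₁ Y₂ hY => ?_⟩
    obtain ⟨B', hB', hb'⟩ := exists_bound_of_memLp_top hY.1
    -- The interval must contain the competitor as well. This is harmless for `X₁`, because the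
    -- first-order condition makes it a maximizer on the whole line.
    have hBB : 0 < max B B' := lt_max_of_lt_left hB
    -- The competitor is sorted by its own uniform variable `V`, unrelated to `U`; the comparison
    -- works because the upper bound depends only on the common law.
    obtain ⟨V, hV, hVmap, hVs⟩ := hP.exists_sortedBy hY.1.1.aemeasurable
    have hY' : ∀ᵐ ω ∂P, |Y₁ ω| ≤ max B B' := by
      filter_upwards [hb'] with ω hω using hω.trans (le_max_right _ _)
    have hbest : ∀ᵐ ω ∂P, X₁ ω = best u₁ u₂ lam c (max B B') (φ (U ω)) := by
      filter_upwards [hUX, hb, hD.ae_nonneg hU hmap] with ω h1 h2 h3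
      exact eq_best hu₁ hu₂ hlam hBB h3 (abs_le.1 (h2.trans (le_max_left _ _)))
        (isMaxOn_obj_of_eq hu₁ hu₂ hlam h3 h1.1.symm _)
    rw [hD.welfare_best hU hmap hu₁ hu₂ hBB hfeas hbest]
    exact (hD.welfare_le_integral_obj hV hVmap hu₁ hu₂ hY hY' hVs).trans
      (hD.integral_obj_le hV hVmap hu₁ hu₂ hBB hY.1.1.aemeasurable hY')

lemma isUniform_Ioo_iff {Ω : Type*} [MeasurableSpace Ω] {P : Measure Ω} {U : Ω → ℝ} :
    pdf.IsUniform U (Ioo 0 1) P volume ↔ P.map U = volume.restrict (Ioo 0 1) := by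
  rw [pdf.IsUniform, ProbabilityTheory.cond, Real.volume_Ioo]
  simp

end Optimality

end Nudging

theorem proposition5p4 {Ω : Type*} [MeasurableSpace Ω] (P : Measure Ω) [IsProbabilityMeasure P]
    (hP : Nudging.IsNonatomic P)
    (u₁ u₂ T f : ℝ → ℝ) (w lam : ℝ)
    (hu₁ : Nudging.IsUtility u₁) (hu₂ : Nudging.IsUtility u₂) (hT : Nudging.IsWeighting T)
    (hf : Nudging.IsNudge w f) (hlam : 0 < lam) :
    -- the convex envelope is differentiable on `(0,1)`, so `δ'(p)` is a genuine derivative there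
    DifferentiableOn ℝ (Nudging.convexEnvelope (Nudging.conj T)) (Ioo 0 1) ∧
    -- the marginal rate `m` is invertible onto its range, and the solutions are characterized
    (∀ M ∈ Icc 0 w,
      StrictMono (Nudging.m u₁ u₂ lam w M) ∧
      ∀ X₁ X₂ : Ω → ℝ, MemLp X₁ ⊤ P → MemLp X₂ ⊤ P →
        (Nudging.Solves P u₁ u₂ (Nudging.nudged T f M) lam (w - M) X₁ X₂ ↔
          ∃ U : Ω → ℝ, Measurable U ∧ pdf.IsUniform U (Ioo 0 1) P volume ∧
            ∀ᵐ ω ∂P, Nudging.phi T f M (U ω) ∈ range (Nudging.m u₁ u₂ lam w M) ∧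
              X₁ ω = Nudging.share u₁ u₂ T f lam w M (U ω) ∧
              X₂ ω = w - M - Nudging.share u₁ u₂ T f lam w M (U ω))) ∧
    -- the closed form of `Λ`
    (∀ M ∈ Icc 0 w, ∀ y ∈ range (Nudging.m u₁ u₂ lam w M),
      DifferentiableAt ℝ (Nudging.m u₁ u₂ lam w M) (Nudging.mInv u₁ u₂ lam w M y) ∧
      Nudging.Lam u₁ u₂ lam w M y =
        -lam / deriv u₁ (Nudging.mInv u₁ u₂ lam w M y) *
          (deriv (deriv u₂) (w - M - Nudging.mInv u₁ u₂ lam w M y) +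
            deriv u₂ (w - M - Nudging.mInv u₁ u₂ lam w M y) *
              (deriv (deriv u₁) (Nudging.mInv u₁ u₂ lam w M y) /
                deriv u₁ (Nudging.mInv u₁ u₂ lam w M y)))) ∧
    -- the sensitivity with respect to the effort level
    (∀ M ∈ Icc 0 w, ∀ p ∈ Ioo (0 : ℝ) 1,
      Nudging.phi T f M p ∈ range (Nudging.m u₁ u₂ lam w M) →
      Nudging.Lam u₁ u₂ lam w M (Nudging.phi T f M p) ≠ 0 →
      (DifferentiableWithinAt ℝ f (Icc 0 w) M →
        HasDerivWithinAt (fun N => Nudging.share u₁ u₂ T f lam w N p)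
          ((-derivWithin f (Icc 0 w) M * (Nudging.delta' T p - 1) +
              lam * (deriv (deriv u₂) (w - M - Nudging.mInv u₁ u₂ lam w M (Nudging.phi T f M p)) /
                deriv u₁ (Nudging.mInv u₁ u₂ lam w M (Nudging.phi T f M p)))) /
            Nudging.Lam u₁ u₂ lam w M (Nudging.phi T f M p))
          (Icc 0 w) M) ∧
      (∀ k : ℕ∞, 1 ≤ k → ContDiff ℝ (k + 1) u₁ → ContDiff ℝ (k + 1) u₂ →
        ContDiffOn ℝ k f (Icc 0 w) →
        ContDiffWithinAt ℝ k (fun N => Nudging.share u₁ u₂ T f lam w N p) (Icc 0 w) M)) := by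
  refine ⟨fun p hp => (hT.isEnvelopable_conj.differentiableAt_convexEnvelope
    hp).differentiableWithinAt, fun M hM => ⟨Nudging.strictMono_m hu₁ hu₂ hlam w M,
    fun X₁ X₂ h₁ h₂ => ?_⟩, fun M _ y _ =>
    ⟨(Nudging.hasDerivAt_m hu₁ hu₂ lam w M _).differentiableAt,
    Nudging.Lam_eq hu₁ hu₂ lam w M y⟩, fun M hM p _ hφ hL => ⟨fun hfM =>
    Nudging.hasDerivWithinAt_share hu₁ hu₂ hlam hφ hL hfM, fun k hk h1 h2 hfk =>
    Nudging.contDiffWithinAt_share hu₁ hu₂ hlam hφ hL hk h1 h2 (hfk M hM)⟩⟩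
  rw [(Nudging.isDualDistortion_nudged hT (hf.mapsTo hM)).solves_iff hP hu₁ hu₂ hlam h₁ h₂]
  refine exists_congr fun U => and_congr_right fun _ =>
    and_congr Nudging.isUniform_Ioo_iff.symm (Filter.eventually_congr (Filter.Eventually.of_forall
      fun ω => ?_))
  -- Injectivity of `m` translates the first-order condition `m(X₁) = φ_M(U)` into `X₁ =
  -- m⁻¹(φ_M(U))`; the range condition is what makes the converse valid.
  constructor
  · rintro ⟨hω, h⟩
    have hω' : Nudging.m u₁ u₂ lam w M (X₁ ω) = Nudging.phi T f M (U ω) := hω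
    have hX : Nudging.share u₁ u₂ T f lam w M (U ω) = X₁ ω := by
      rw [Nudging.share, ← hω', Nudging.mInv_m hu₁ hu₂ hlam]
    exact ⟨⟨_, hω'⟩, hX.symm, by rw [hX, h]⟩
  · rintro ⟨⟨x, hx⟩, hX, h⟩
    have hX' : X₁ ω = x := by
      rw [hX, Nudging.share, ← hx, Nudging.mInv_m hu₁ hu₂ hlam]
    refine ⟨?_, by rw [h, hX]⟩
    rw [hX']
    exact hx
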